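/- Let $W$ be a finite-dimensional vector space $V$ over a finite field $K$ equipped with a non-degenerate alternating, quadratic or Hermitian form (for a quadratic form $Q$ in any characteristic, non-degenerate means that $Q$ has no nonzero zero in the radical of its polar form). Write $B$ for the form (the polar form of $Q$ in the quadratic case), $U^\perp=\{v\in V: B(u,v)=0\ \text{for all } u\in U\}$, call a subspace singular if it is totally isotropic (in the quadratic case: if $Q$ vanishes on it), and let $\omega$ be the Witt index, i.e. the largest dimension of a singular subspace. Let $1\le k<\omega$, and let $\Gamma=PG_W(k)$ be the polar Grassmann graph: its vertices are the singular $k$-subspaces, and $u,v$ are adjacent when $u+v$ is a singular $(k+1)$-subspace. Distinct vertices $X,Y$ are *opposite* if for every $y\in Y\setminus X$ there is $x\in X\setminus Y$ with $B(x,y)\neq 0$. Let $m\ge 1$ and consider the geodesics $L=(X_0,\dots,X_m)$ of length $m$ in $\Gamma$ whose ends $X_0,X_m$ are not opposite. A linearly independent system $M=\{x_1,\dots,x_m,\,y_1,\dots,y_m,\,w_1,\dots,w_{k-m}\}$ of vectors *induces* $L$ if $$X_i=\langle x_1,\dots,x_{m-i},\,y_{m-i+1},\dots,y_m,\,w_1,\dots,w_{k-m}\rangle\qquad(0\le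 i\le m).$$ It satisfies (R1) if for each $i$ either $B(x_i,y_j)=0$ for all $j$, or there is $i'<i$ with $B(x_i,y_{i'})=1$ and $B(x_i,y_j)=0$ for all $j\ne i'$, where different $i$ have different $i'$. The relation (R1) that $M$ satisfies is then recorded by the set $\rho=\{(i,i'): B(x_i,y_{i'})=1\}$; we say that $L$ has relation $\rho$ if it is induced by some such $M$. Then: 1. Every geodesic of length $m$ with non-opposite ends has exactly one relation $\rho$. 2. Two geodesics $L,L'$ of length $m$ with non-opposite ends lie in the same orbit of the full automorphism group $\operatorname{Aut}\Gamma$ if and only if they have the same relation. 3. For each relation $\rho$ that occurs, the geodesics of length $m$ with non-opposite ends that have the relation $\rho$ form exactly one orbit of the isometry group of $W$ (the linear bijections of $V$ preserving the form). 4. Different relations are told apart by the dimensions $\delta(X,Y)=\dim\,(X\cap Y^\perp)/(X\cap Y)$: if $L=(X_i)$ and $L''=(X''_i)$ are geodesics of length $m$ with non-opposite ends and relations $\rho$ and $\rho''$, then $\rho=\rho''$ if and only if $\delta(X_i,X_j)=\delta(X''_i,X''_j)$ for all $i,j$. More precisely, if $\rho$ and $\rho''$ agree on all pairs with first entry less than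 $a$, $(a,b)\in\rho$, and either $(a,c)\in\rho''$ for some $c<b$ or no pair of $\rho''$ has first entry $a$, then $$\delta(X_{m-a},X_{m-b+1})=\delta(X''_{m-a},X''_{m-b+1})-1 .$$ -/

import Mathlib

/-- The classical formed spaces `W` over `K` with underlying vector space `V`: a non-degenerate
alternating form (symplectic spaces), a non-degenerate quadratic form (orthogonal spaces, in any
characteristic), or a non-degenerate Hermitian form with respect to an involution of `K` of order
two (unitary spaces). -/
inductive FormedSpace (K V : Type*) [Field K] [AddCommGroup V] [Module K V] where
  | symplectic (B : V →ₗ[K] V →ₗ[K] K) (alternating : ∀ v, B v v = 0)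
      (nondegenerate : ∀ v, (∀ u, B v u = 0) → v = 0) : FormedSpace K V
  | orthogonal (Q : QuadraticForm K V)
      (nondegenerate : ∀ v, (∀ u, QuadraticMap.polar Q v u = 0) → Q v = 0 → v = 0) :
      FormedSpace K V
  | unitary (conj : K ≃+* K) (involutive : ∀ a, conj (conj a) = a) (nontrivial : ∃ a, conj a ≠ a)
      (B : V →ₗ[K] V →ₛₗ[(conj : K →+* K)] K) (hermitian : ∀ u v, B v u = conj (B u v))
      (nondegenerate : ∀ v, (∀ u, B v u = 0) → v = 0) : FormedSpace K V

namespace FormedSpace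

variable {K V : Type*} [Field K] [AddCommGroup V] [Module K V]

/-- The sesquilinear form `B(u, v)` of `W`; for an orthogonal space it is the polar form
`Q (u + v) - Q u - Q v`. -/
def form : FormedSpace K V → V → V → K
  | symplectic B _ _, u, v => B u v
  | orthogonal Q _, u, v => QuadraticMap.polar Q u v
  | unitary _ _ _ B _ _, u, v => B u v

/-- Singular subspaces: totally isotropic ones in the symplectic and unitary cases, totally
singular ones (`Q` vanishes on them) in the orthogonal case. -/
def IsSingular : FormedSpace K V → Submodule K V → Prop
  | symplectic B _ _, U => ∀ u ∈ U, ∀ v ∈ U, B u v = 0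
  | orthogonal Q _, U => ∀ u ∈ U, Q u = 0
  | unitary _ _ _ B _ _, U => ∀ u ∈ U, ∀ v ∈ U, B u v = 0

/-- The linear bijection `g` of `V` preserves the form (the quadratic form, in the orthogonal
case). -/
def IsIsometry : FormedSpace K V → (V ≃ₗ[K] V) → Prop
  | symplectic B _ _, g => ∀ u v, B (g u) (g v) = B u v
  | orthogonal Q _, g => ∀ v, Q (g v) = Q v
  | unitary _ _ _ B _ _, g => ∀ u v, B (g u) (g v) = B u v

/-- The subspace `U^⊥` of the vectors `v` with `B(u, v) = 0` for all `u ∈ U`. -/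
def perp (W : FormedSpace K V) (U : Submodule K V) : Submodule K V where
  carrier := {v | ∀ u ∈ U, W.form u v = 0}
  zero_mem' := by
    intro u _
    cases W <;> simp only [form]
    · rw [map_zero]
    · rw [QuadraticMap.polar_zero_right]
    · rw [map_zero]
  add_mem' := by
    intro v v' hv hv' u hu
    have h := hv u hu
    have h' := hv' u hu
    cases W <;> simp only [form] at h h' ⊢
    · rw [map_add, h, h', add_zero]
    · rw [QuadraticMap.polar_add_right, h, h', add_zero]
    · rw [map_add, h, h', add_zero]
  smul_mem' := by
    intro c v hv u hu
    have h := hv u hu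
    cases W <;> simp only [form] at h ⊢
    · rw [map_smul, h, smul_zero]
    · rw [QuadraticMap.polar_smul_right, h, smul_zero]
    · rw [LinearMap.map_smulₛₗ, h, smul_zero]

/-- The Witt index `ω` of `W`: the largest dimension of a singular subspace. -/
noncomputable def wittIndex (W : FormedSpace K V) : ℕ :=
  sSup {d | ∃ U : Submodule K V, W.IsSingular U ∧ Module.finrank K U = d}

/-- The set of singular `k`-subspaces of `W`. -/
abbrev SingularSubspace (W : FormedSpace K V) (k : ℕ) : Type _ :=
  {U : Submodule K V // W.IsSingular U ∧ Module.finrank K U = k}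

/-- The polar Grassmann graph on the singular `k`-subspaces: if `k = ω`, then `u, v` are adjacent
when `dim (u ∩ v) = k - 1`; if `k < ω`, then `u, v` are adjacent when `u + v` is a singular
`(k + 1)`-subspace. -/
def polarGrassmannGraph (W : FormedSpace K V) (k : ℕ) : SimpleGraph (W.SingularSubspace k) where
  Adj u v :=
    (k = W.wittIndex ∧ Module.finrank K (u.1 ⊓ v.1 : Submodule K V) + 1 = k) ∨
    (k < W.wittIndex ∧ W.IsSingular (u.1 ⊔ v.1) ∧
      Module.finrank K (u.1 ⊔ v.1 : Submodule K V) = k + 1)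
  symm := ⟨by
    intro u v h
    rwa [inf_comm v.1 u.1, sup_comm v.1 u.1]⟩
  loopless := ⟨by
    intro u h
    have hu := u.2.2
    rw [inf_idem, sup_idem, hu] at h
    omega⟩

/-- Two distinct vertices `X, Y` are opposite: each vector of `Y` outside `X` is
non-orthogonal to some vector of `X` outside `Y`. -/
def Opposite (W : FormedSpace K V) {k : ℕ} (X Y : W.SingularSubspace k) : Prop :=
  X ≠ Y ∧ ∀ y ∈ Y.1, y ∉ X.1 → ∃ x ∈ X.1, x ∉ Y.1 ∧ W.form x y ≠ 0

end FormedSpace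

/-- The sequence `L = (L 0, …, L m)` of vertices is a geodesic of length `m` in `G`: a path of
shortest length between its ends. -/
def IsGeodesicSeq {X : Type*} (G : SimpleGraph X) {m : ℕ} (L : Fin (m + 1) → X) : Prop :=
  (∀ i : Fin m, G.Adj (L i.castSucc) (L i.succ)) ∧ G.dist (L 0) (L (Fin.last m)) = m

/-- A family of vectors `x_1, …, x_m, y_1, …, y_m, w_1, …, w_{k-m}` of `V` (numbered from `0`
in the code). -/
structure VectorSystem (V : Type*) (k m : ℕ) where
  x : Fin m → V
  y : Fin m → V
  w : Fin (k - m) → V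

namespace FormedSpace

variable {K V : Type*} [Field K] [AddCommGroup V] [Module K V]

/-- `L` is a geodesic of length `m` in the polar Grassmann graph with non-opposite ends. -/
def IsNonoppositeGeodesic (W : FormedSpace K V) {k m : ℕ}
    (L : Fin (m + 1) → W.SingularSubspace k) : Prop :=
  IsGeodesicSeq (W.polarGrassmannGraph k) L ∧ ¬ W.Opposite (L 0) (L (Fin.last m))

/-- The system `M` is linearly independent and induces `L = (X_0, …, X_m)` by
`X_i = ⟨x_1, …, x_{m-i}, y_{m-i+1}, …, y_m, w_1, …, w_{k-m}⟩`. -/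
def Induces (W : FormedSpace K V) {k m : ℕ} (M : VectorSystem V k m)
    (L : Fin (m + 1) → W.SingularSubspace k) : Prop :=
  LinearIndependent K (Sum.elim M.x (Sum.elim M.y M.w)) ∧
  ∀ i : Fin (m + 1), (L i).1 = Submodule.span K
    (M.x '' {j | (j : ℕ) + i < m} ∪ M.y '' {j | m ≤ (j : ℕ) + i} ∪ Set.range M.w)

/-- The relation (R1): for each `i`, either `B(x_i, y_j) = 0` for all `j`, or `B(x_i, y_{i'}) = 1`
for some `i' < i` and `B(x_i, y_j) = 0` for all `j ≠ i'`; moreover the indices `i'` that belong to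
different `i` are different. -/
def SatisfiesR1 (W : FormedSpace K V) {k m : ℕ} (M : VectorSystem V k m) : Prop :=
  (∀ i : Fin m, (∀ j, W.form (M.x i) (M.y j) = 0) ∨
    ∃ i' < i, W.form (M.x i) (M.y i') = 1 ∧ ∀ j, j ≠ i' → W.form (M.x i) (M.y j) = 0) ∧
  ∀ i j i' j' : Fin m, W.form (M.x i) (M.y i') = 1 → W.form (M.x j) (M.y j') = 1 →
    i ≠ j → i' ≠ j'

/-- Which relation (R1) the system `M` satisfies: the set of the pairs `(i, i')` with
`B(x_i, y_{i'}) = 1`. -/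
def relationOf (W : FormedSpace K V) {k m : ℕ} (M : VectorSystem V k m) : Set (Fin m × Fin m) :=
  {p | W.form (M.x p.1) (M.y p.2) = 1}

/-- `L` is induced by a system of vectors that satisfies (R1) with the relation `ρ`. -/
def HasRelation (W : FormedSpace K V) {k m : ℕ} (L : Fin (m + 1) → W.SingularSubspace k)
    (ρ : Set (Fin m × Fin m)) : Prop :=
  ∃ M : VectorSystem V k m, W.Induces M L ∧ W.SatisfiesR1 M ∧ W.relationOf M = ρ

/-- `L` and `L'` lie in the same orbit of the full automorphism group of the polar Grassmann
graph. -/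
def SameAutOrbit (W : FormedSpace K V) {k m : ℕ}
    (L L' : Fin (m + 1) → W.SingularSubspace k) : Prop :=
  ∃ φ : W.polarGrassmannGraph k ≃g W.polarGrassmannGraph k, ∀ i, φ (L i) = L' i

/-- `L` and `L'` lie in the same orbit of the isometry group of `W`. -/
def SameIsometryOrbit (W : FormedSpace K V) {k m : ℕ}
    (L L' : Fin (m + 1) → W.SingularSubspace k) : Prop :=
  ∃ g : V ≃ₗ[K] V, W.IsIsometry g ∧ ∀ i, (L i).1.map (g : V →ₗ[K] V) = (L' i).1

/-- The dimension of `(X ∩ Y^⊥) / (X ∩ Y)`. -/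
noncomputable def perpDim (W : FormedSpace K V) {k : ℕ} (X Y : W.SingularSubspace k) : ℕ :=
  Module.finrank K
    (↥(X.1 ⊓ W.perp Y.1) ⧸ (X.1 ⊓ Y.1 : Submodule K V).submoduleOf (X.1 ⊓ W.perp Y.1))

end FormedSpace

/-!
# Geodesics with non-opposite ends in polar Grassmann graphs

The idea is that a geodesic `X_0, …, X_m` with non-opposite ends is a pair of flags together with a
pairing, so that its relation (R1) is the permutation matrix of a Bruhat decomposition.

Write `δ(X, Y) = dim (X ∩ Y^⊥) / (X ∩ Y)`. Distinct vertices are opposite exactly when `δ = 0`, and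
vertices with `δ > 0` have distance `k - dim (X ∩ Y)`: one can move towards `Y` keeping a vector of
`X ∩ Y^⊥` outside `Y` (`exists_walk_length_eq`). Hence `dim (X_i ∩ X_j) = k - |i - j|` along the
geodesic, the subspaces `X_0 ∩ X_j` and `X_m ∩ X_j` form two flags with sums `X_j`, and consecutive
vertices being orthogonal says that the matrix `B(x_i, y_j)` of bases adapted to the flags is
strictly lower triangular. Adapted changes of the bases are the row and column operations that
bring the matrix to a partial permutation matrix (`exists_partial_permutation`); this gives a
system with (R1).

The pairing of `X_i` with `X_j` has the rank of a corner of this matrix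
(`IsNonoppositeGeodesic.perpDim_add_cornerRank`), so the numbers `δ(X_i, X_j)` and the matrix
determine each other, which gives the uniqueness of the relation and the last part of the theorem.

Two systems with the same relation are conjugate under isometries. Their vectors form partial
families of pairwise orthogonal hyperbolic pairs; such families can be completed
(`IsHyperbolicFamily.exists_complete`), and complete families are conjugate, one pair after the
other, since hyperbolic pairs can be moved by an isometry that fixes everything orthogonal to the
two pairs (`exists_isIsometry_hyperbolic_pair`). The isometries used are reflections or
transvections and Siegel transformations, so that the radical of the polar form in characteristic
two needs no attention.

Finally, graph automorphisms preserve `δ(X_i, X_j)` (`perpDim_apply_eq`). The neighbours of `X`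
that are closer to `Y` are sums `F + G` of a hyperplane `F ⊇ X ∩ Y` of `X` and an extension `G` of
`X ∩ Y` by one dimension in `Y ∩ X^⊥`. If `δ(X, Y) ≥ 2`, all such pairs occur, and over a finite
field their number grows strictly with `δ(X, Y)`.
-/

open Module

/-! ### Forms, singular vectors and isometries -/

namespace FormedSpace

variable {K V : Type*} [Field K] [AddCommGroup V] [Module K V]

/-- The automorphism `σ` of `K` with `B(u, c v) = σ(c) B(u, v)`: the involution in the unitary
case, the identity otherwise. -/
def twist : FormedSpace K V → K ≃+* K
  | symplectic _ _ _ => RingEquiv.refl K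
  | orthogonal _ _ => RingEquiv.refl K
  | unitary conj _ _ _ _ _ => conj

/-- A vector is singular when the line that it spans is singular. -/
def IsSingularVector : FormedSpace K V → V → Prop
  | symplectic _ _ _, _ => True
  | orthogonal Q _, v => Q v = 0
  | unitary _ _ _ B _ _, v => B v v = 0

section Form

variable (W : FormedSpace K V)

theorem form_add_left (u u' v : V) : W.form (u + u') v = W.form u v + W.form u' v := by
  cases W <;> simp [form, QuadraticMap.polar_add_left]

theorem form_smul_left (c : K) (u v : V) : W.form (c • u) v = c * W.form u v := by
  cases W <;> simp [form, QuadraticMap.polar_smul_left]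

theorem form_add_right (u v v' : V) : W.form u (v + v') = W.form u v + W.form u v' := by
  cases W <;> simp [form, QuadraticMap.polar_add_right]

theorem form_smul_right (c : K) (u v : V) : W.form u (c • v) = W.twist c * W.form u v := by
  cases W <;> simp [form, twist, QuadraticMap.polar_smul_right]

/-- The linear functional `z ↦ B(z, v)`. -/
def formLeft (v : V) : V →ₗ[K] K where
  toFun z := W.form z v
  map_add' z z' := W.form_add_left z z' v
  map_smul' c z := W.form_smul_left c z v

@[simp] theorem formLeft_apply (v z : V) : W.formLeft v z = W.form z v := rfl

@[simp] theorem form_zero_left (v : V) : W.form 0 v = 0 := (W.formLeft v).map_zero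

@[simp] theorem form_zero_right (u : V) : W.form u 0 = 0 := by
  simpa using W.form_smul_right 0 u 0

theorem form_neg_right (u v : V) : W.form u (-v) = -W.form u v := by
  have h := W.form_add_right u v (-v)
  rw [add_neg_cancel, form_zero_right] at h
  exact (neg_eq_of_add_eq_zero_right h.symm).symm

theorem form_sub_left (u u' v : V) : W.form (u - u') v = W.form u v - W.form u' v :=
  (W.formLeft v).map_sub u u'

theorem form_sub_right (u v v' : V) : W.form u (v - v') = W.form u v - W.form u v' := by
  rw [sub_eq_add_neg, form_add_right, form_neg_right, sub_eq_add_neg]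

theorem form_sum_left {ι : Type*} (s : Finset ι) (f : ι → V) (v : V) :
    W.form (∑ i ∈ s, f i) v = ∑ i ∈ s, W.form (f i) v :=
  map_sum (W.formLeft v) f s

theorem form_sum_right {ι : Type*} (s : Finset ι) (f : ι → V) (u : V) :
    W.form u (∑ i ∈ s, f i) = ∑ i ∈ s, W.form u (f i) := by
  classical
  induction s using Finset.induction_on with
  | empty => simp
  | insert a s ha ih => rw [Finset.sum_insert ha, Finset.sum_insert ha, form_add_right, ih]

theorem twist_twist (c : K) : W.twist (W.twist c) = c := by
  cases W with
  | symplectic => rfl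
  | orthogonal => rfl
  | unitary conj inv _ _ _ _ => exact inv c

/-- The form is determined up to sign and twist by its values with swapped arguments; the sign is
the same for all vectors. -/
theorem exists_form_swap : ∃ ε : K, ε * ε = 1 ∧ W.twist ε = ε ∧
    ∀ u v, W.form v u = ε * W.twist (W.form u v) := by
  cases W with
  | symplectic B alt _ =>
    refine ⟨-1, by ring, by simp, fun u v => ?_⟩
    simp only [form, twist, RingEquiv.refl_apply]
    rw [← LinearMap.IsAlt.neg (B := B) alt u v, neg_one_mul]
  | orthogonal Q _ =>
    exact ⟨1, by ring, by simp, fun u v => by simp [form, twist, QuadraticMap.polar_comm Q v u]⟩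
  | unitary conj _ _ B herm _ =>
    exact ⟨1, by ring, by simp, fun u v => by simp [form, twist, herm u v]⟩

theorem form_eq_zero_swap {u v : V} (h : W.form u v = 0) : W.form v u = 0 := by
  obtain ⟨ε, -, -, hε⟩ := W.exists_form_swap
  rw [hε, h, map_zero, mul_zero]

theorem form_eq_zero_comm {u v : V} : W.form u v = 0 ↔ W.form v u = 0 :=
  ⟨W.form_eq_zero_swap, W.form_eq_zero_swap⟩

theorem mem_perp {U : Submodule K V} {v : V} : v ∈ W.perp U ↔ ∀ u ∈ U, W.form u v = 0 := Iff.rfl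

theorem mem_perp' {U : Submodule K V} {v : V} : v ∈ W.perp U ↔ ∀ u ∈ U, W.form v u = 0 := by
  simp only [mem_perp, W.form_eq_zero_comm (v := v)]

theorem eq_zero_of_forall_form_eq_zero {v : V} (h : ∀ u, W.form v u = 0)
    (hv : W.IsSingularVector v) : v = 0 := by
  cases W with
  | symplectic B alt nd => exact nd v h
  | orthogonal Q nd => exact nd v h hv
  | unitary conj _ _ B herm nd => exact nd v h

end Form

section Singular

variable {W : FormedSpace K V}

theorem IsSingularVector.form_self {v : V} (h : W.IsSingularVector v) : W.form v v = 0 := by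
  cases W with
  | symplectic B alt nd => exact alt v
  | orthogonal Q nd =>
    have h' : Q v = 0 := h
    simp [form, QuadraticMap.polar_self, h']
  | unitary conj _ _ B herm nd => exact h

theorem IsSingularVector.add {u v : V} (hu : W.IsSingularVector u) (hv : W.IsSingularVector v)
    (h : W.form u v = 0) : W.IsSingularVector (u + v) := by
  have h' := W.form_eq_zero_swap h
  cases W with
  | symplectic B alt nd => trivial
  | orthogonal Q nd =>
    have hu' : Q u = 0 := hu
    have hv' : Q v = 0 := hv
    have h'' : Q (u + v) - Q u - Q v = 0 := h
    simpa [IsSingularVector, hu', hv'] using h''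
  | unitary conj _ _ B herm nd =>
    have hu' : B u u = 0 := hu
    have hv' : B v v = 0 := hv
    have h1 : B u v = 0 := h
    have h2 : B v u = 0 := h'
    simp [IsSingularVector, hu', hv', h1, h2]

theorem IsSingularVector.smul {v : V} (hv : W.IsSingularVector v) (c : K) :
    W.IsSingularVector (c • v) := by
  cases W with
  | symplectic B alt nd => trivial
  | orthogonal Q nd =>
    have hv' : Q v = 0 := hv
    simp [IsSingularVector, QuadraticMap.map_smul, hv']
  | unitary conj _ _ B herm nd =>
    have hv' : B v v = 0 := hv
    simp [IsSingularVector, hv']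

theorem isSingular_iff {U : Submodule K V} : W.IsSingular U ↔
    (∀ u ∈ U, W.IsSingularVector u) ∧ ∀ u ∈ U, ∀ v ∈ U, W.form u v = 0 := by
  cases W with
  | symplectic B alt nd => exact ⟨fun h => ⟨fun _ _ => trivial, h⟩, fun h => h.2⟩
  | orthogonal Q nd =>
    refine ⟨fun h => ⟨h, fun u hu v hv => ?_⟩, fun h => h.1⟩
    have h1 := h u hu
    have h2 := h v hv
    have h3 := h _ (U.add_mem hu hv)
    simp [form, QuadraticMap.polar, h1, h2, h3]
  | unitary conj _ _ B herm nd => exact ⟨fun h => ⟨fun u hu => h u hu u hu, h⟩, fun h => h.2⟩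

theorem IsSingular.isSingularVector {U : Submodule K V} (h : W.IsSingular U) {u : V}
    (hu : u ∈ U) : W.IsSingularVector u := (isSingular_iff.1 h).1 u hu

theorem IsSingular.form_eq_zero {U : Submodule K V} (h : W.IsSingular U) {u v : V}
    (hu : u ∈ U) (hv : v ∈ U) : W.form u v = 0 := (isSingular_iff.1 h).2 u hu v hv

theorem IsSingular.le_perp {U : Submodule K V} (h : W.IsSingular U) : U ≤ W.perp U :=
  fun _ hv _ hu => h.form_eq_zero hu hv

theorem IsSingular.mono {U U' : Submodule K V} (h : W.IsSingular U') (hU : U ≤ U') :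
    W.IsSingular U :=
  isSingular_iff.2 ⟨fun _ hu => h.isSingularVector (hU hu),
    fun _ hu _ hv => h.form_eq_zero (hU hu) (hU hv)⟩

theorem IsSingular.sup {U U' : Submodule K V} (h : W.IsSingular U) (h' : W.IsSingular U')
    (hUU' : ∀ u ∈ U, ∀ v ∈ U', W.form u v = 0) : W.IsSingular (U ⊔ U') := by
  refine isSingular_iff.2 ⟨fun z hz => ?_, fun z hz z' hz' => ?_⟩
  · obtain ⟨u, hu, v, hv, rfl⟩ := Submodule.mem_sup.1 hz
    exact (h.isSingularVector hu).add (h'.isSingularVector hv) (hUU' u hu v hv)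
  · obtain ⟨u, hu, v, hv, rfl⟩ := Submodule.mem_sup.1 hz
    obtain ⟨u', hu', v', hv', rfl⟩ := Submodule.mem_sup.1 hz'
    rw [form_add_left, form_add_right, form_add_right, h.form_eq_zero hu hu',
      h'.form_eq_zero hv hv', hUU' u hu v' hv', W.form_eq_zero_swap (hUU' u' hu' v hv)]
    simp

end Singular

section Isometry

variable {W : FormedSpace K V}

theorem IsIsometry.form_eq {g : V ≃ₗ[K] V} (hg : W.IsIsometry g) (u v : V) :
    W.form (g u) (g v) = W.form u v := by
  cases W with
  | symplectic B alt nd => exact hg u v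
  | orthogonal Q nd =>
    have h : ∀ v, Q (g v) = Q v := hg
    simp only [form, QuadraticMap.polar]
    rw [← map_add, h, h, h]
  | unitary conj _ _ B herm nd => exact hg u v

theorem IsIsometry.isSingularVector_iff {g : V ≃ₗ[K] V} (hg : W.IsIsometry g) (v : V) :
    W.IsSingularVector (g v) ↔ W.IsSingularVector v := by
  cases W with
  | symplectic B alt nd => exact Iff.rfl
  | orthogonal Q nd =>
    have h : Q (g v) = Q v := hg v
    simp [IsSingularVector, h]
  | unitary conj _ _ B herm nd =>
    have h : B (g v) (g v) = B v v := hg v v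
    simp [IsSingularVector, h]

theorem isIsometry_refl (W : FormedSpace K V) : W.IsIsometry (LinearEquiv.refl K V) := by
  cases W <;> simp [IsIsometry]

theorem IsIsometry.trans {g h : V ≃ₗ[K] V} (hg : W.IsIsometry g) (hh : W.IsIsometry h) :
    W.IsIsometry (g.trans h) := by
  cases W with
  | symplectic B alt nd => exact fun u v => (hh (g u) (g v)).trans (hg u v)
  | orthogonal Q nd => exact fun v => (hh (g v)).trans (hg v)
  | unitary conj _ _ B herm nd => exact fun u v => (hh (g u) (g v)).trans (hg u v)

theorem IsIsometry.symm {g : V ≃ₗ[K] V} (hg : W.IsIsometry g) : W.IsIsometry g.symm := by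
  cases W with
  | symplectic B alt nd => exact fun u v => by simpa using (hg (g.symm u) (g.symm v)).symm
  | orthogonal Q nd => exact fun v => by simpa using (hg (g.symm v)).symm
  | unitary conj _ _ B herm nd =>
    exact fun u v => by simpa using (hg (g.symm u) (g.symm v)).symm

theorem IsIsometry.isSingular_map {g : V ≃ₗ[K] V} (hg : W.IsIsometry g) {U : Submodule K V}
    (hU : W.IsSingular U) : W.IsSingular (U.map (g : V →ₗ[K] V)) := by
  refine isSingular_iff.2 ⟨?_, ?_⟩
  · rintro _ ⟨u, hu, rfl⟩
    exact (hg.isSingularVector_iff u).2 (hU.isSingularVector hu)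
  · rintro _ ⟨u, hu, rfl⟩ _ ⟨v, hv, rfl⟩
    exact (hg.form_eq u v).trans (hU.form_eq_zero hu hv)

end Isometry

end FormedSpace

/-! ### Transitivity on hyperbolic pairs -/

namespace FormedSpace

variable {K V : Type*} [Field K] [AddCommGroup V] [Module K V]

section Generators

theorem injective_of_form_eq (W : FormedSpace K V) {T : V →ₗ[K] V}
    (hT : ∀ u v, W.form (T u) (T v) = W.form u v)
    (hrad : ∀ z, (∀ u, W.form z u = 0) → T z = z) : Function.Injective T := by
  refine (injective_iff_map_eq_zero T).2 fun z hz => ?_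
  rw [← hrad z fun u => by rw [← hT, hz, form_zero_left], hz]

variable [FiniteDimensional K V] (W : FormedSpace K V)

/-- The (quasi-)reflection or transvection that moves the singular vector `e` to a singular
vector `e'` not orthogonal to it: `z ↦ z + B(e, e')⁻¹ B(z, e - e') (e - e')`. -/
theorem exists_isIsometry_of_form_ne_zero {e e' : V} (he : W.IsSingularVector e)
    (he' : W.IsSingularVector e') (hee' : W.form e e' ≠ 0) :
    ∃ g : V ≃ₗ[K] V, W.IsIsometry g ∧ g e = e' ∧
      ∀ z, W.form z e = 0 → W.form z e' = 0 → g z = z := by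
  set b := W.form e e' with hb
  let T : V →ₗ[K] V := LinearMap.id + (b⁻¹ • W.formLeft (e - e')).smulRight (e - e')
  have hT : ∀ z, T z = z + (b⁻¹ * (W.form z e - W.form z e')) • (e - e') := fun z => by
    simp [T, form_sub_right]
  have hrad : ∀ z, (∀ u, W.form z u = 0) → T z = z := fun z hz => by simp [hT, hz]
  have hTe : T e = e' := by
    rw [hT, he.form_self, zero_sub, ← hb, mul_neg, inv_mul_cancel₀ hee']
    simp
  have hfix : ∀ z, W.form z e = 0 → W.form z e' = 0 → T z = z := fun z h h' => by
    simp [hT, h, h']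
  cases W with
  | symplectic B alt nd =>
    have hsw : ∀ u v, B v u = -B u v := fun u v =>
      (LinearMap.IsAlt.neg (B := B) alt u v).symm
    have hpres : ∀ u v, B (T u) (T v) = B u v := fun u v => by
      simp only [hT, form, map_add, LinearMap.add_apply, map_smul, LinearMap.smul_apply, map_sub,
        LinearMap.sub_apply, alt, hsw e e', smul_eq_mul]
      rw [hsw e v, hsw e' v]
      ring
    refine ⟨LinearEquiv.ofInjectiveEndo T (injective_of_form_eq (symplectic B alt nd) hpres hrad),
      ?_, hTe, hfix⟩
    exact hpres
  | orthogonal Q nd =>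
    have hQe : Q e = 0 := he
    have hQe' : Q e' = 0 := he'
    have hb' : Q (e - e') = -b := by
      rw [hb]
      simp only [form]
      rw [sub_eq_add_neg, QuadraticMap.map_add Q, QuadraticMap.polar_neg_right, hQe,
        QuadraticMap.map_neg, hQe']
      ring
    have hpres : ∀ v, Q (T v) = Q v := fun v => by
      rw [hT, QuadraticMap.map_add Q, QuadraticMap.map_smul, QuadraticMap.polar_smul_right, hb']
      simp only [form, sub_eq_add_neg, QuadraticMap.polar_add_right, QuadraticMap.polar_neg_right,
        smul_eq_mul]
      field_simp
      ring
    have hpres' : ∀ u v, (orthogonal Q nd).form (T u) (T v) = (orthogonal Q nd).form u v := by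
      intro u v
      simp only [form, QuadraticMap.polar]
      rw [← map_add, hpres, hpres, hpres]
    refine ⟨LinearEquiv.ofInjectiveEndo T (injective_of_form_eq _ hpres' hrad), ?_, hTe, hfix⟩
    exact hpres
  | unitary conj inv nt B herm nd =>
    have hBe : B e e = 0 := he
    have hBe' : B e' e' = 0 := he'
    have hb1 : B e e' = b := rfl
    have hb2 : B e' e = conj b := herm e e'
    have hcb : conj b ≠ 0 := by simpa using hee'
    have hpres : ∀ u v, B (T u) (T v) = B u v := fun u v => by
      simp only [hT, form, map_add, LinearMap.add_apply, map_smul, LinearMap.smul_apply, map_sub,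
        LinearMap.sub_apply, LinearMap.map_smulₛₗ, hBe, hBe', hb1, hb2, smul_eq_mul,
        RingHom.coe_coe, map_mul, map_inv₀, herm v e, herm v e']
      field_simp
      ring
    refine ⟨LinearEquiv.ofInjectiveEndo T (injective_of_form_eq (unitary conj inv nt B herm nd) hpres hrad),
      ?_, hTe, hfix⟩
    exact hpres

/-- The Siegel transformation that fixes the singular vector `e` and moves a singular vector `f`
with `B(e, f) = 1` to another such vector `f'`. With `u = f' - f` and `η = B(f, e) = ±1` it is
`z ↦ z + η B(z, e) u - (B(z, u) - η B(f, u) B(z, e)) e`. -/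
theorem exists_isIsometry_fixing {e f f' : V} (he : W.IsSingularVector e)
    (hf : W.IsSingularVector f) (hf' : W.IsSingularVector f') (hef : W.form e f = 1)
    (hef' : W.form e f' = 1) :
    ∃ g : V ≃ₗ[K] V, W.IsIsometry g ∧ g e = e ∧ g f = f' ∧
      ∀ z, W.form z e = 0 → W.form z f = 0 → W.form z f' = 0 → g z = z := by
  obtain ⟨ε, hε, -, hsw⟩ := W.exists_form_swap
  have hfe : W.form f e = ε := by rw [hsw, hef, map_one, mul_one]
  obtain ⟨u, rfl⟩ : ∃ u, f' = f + u := ⟨f' - f, by abel⟩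
  have heu : W.form e u = 0 := by
    rw [form_add_right, hef] at hef'
    linear_combination hef'
  have hue : W.form u e = 0 := W.form_eq_zero_swap heu
  let T : V →ₗ[K] V := LinearMap.id + (ε • W.formLeft e).smulRight u
    - (W.formLeft u - (ε * W.form f u) • W.formLeft e).smulRight e
  have hT : ∀ z, T z = z + (ε * W.form z e) • u -
      (W.form z u - ε * W.form f u * W.form z e) • e := fun z => by simp [T]
  have hrad : ∀ z, (∀ u, W.form z u = 0) → T z = z := fun z hz => by simp [hT, hz]
  have hTe : T e = e := by simp [hT, he.form_self, heu]
  have hTf : T f = f + u := by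
    rw [hT, hfe, hε, mul_right_comm, hε, one_mul, one_smul, sub_self, zero_smul, sub_zero]
  have hfix : ∀ z, W.form z e = 0 → W.form z f = 0 → W.form z (f + u) = 0 → T z = z :=
    fun z h h1 h2 => by
      rw [form_add_right, h1, zero_add] at h2
      simp [hT, h, h2]
  cases W with
  | symplectic B alt nd =>
    have hsw' : ∀ u v, B v u = -B u v := fun u v =>
      (LinearMap.IsAlt.neg (B := B) alt u v).symm
    have hεv : ε = -1 := by
      rw [← hfe]
      exact (hsw' e f).trans (congrArg Neg.neg hef)
    have heu0 : B e u = 0 := heu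
    have hue0 : B u e = 0 := hue
    have hpres : ∀ u v, B (T u) (T v) = B u v := fun z v => by
      simp only [hT, form, map_add, LinearMap.add_apply, map_smul, LinearMap.smul_apply, map_sub,
        LinearMap.sub_apply, alt, heu0, hue0, smul_eq_mul, hεv]
      rw [hsw' v e, hsw' v u]
      ring
    refine ⟨LinearEquiv.ofInjectiveEndo T (injective_of_form_eq (symplectic B alt nd) hpres hrad),
      ?_, hTe, hTf, hfix⟩
    exact hpres
  | orthogonal Q nd =>
    have hεv : ε = 1 := by
      rw [← hfe]
      exact (QuadraticMap.polar_comm Q f e).trans hef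
    have hQe : Q e = 0 := he
    have hQf : Q f = 0 := hf
    have hQf' : Q (f + u) = 0 := hf'
    have hQu : Q u = -QuadraticMap.polar Q f u := by
      rw [QuadraticMap.map_add Q, hQf] at hQf'
      linear_combination hQf'
    have hue0 : QuadraticMap.polar Q u e = 0 := hue
    have hpres : ∀ v, Q (T v) = Q v := fun v => by
      rw [hT, sub_eq_add_neg, QuadraticMap.map_add Q, QuadraticMap.map_add Q v,
        QuadraticMap.map_neg, QuadraticMap.polar_neg_right, QuadraticMap.polar_add_left,
        QuadraticMap.map_smul, QuadraticMap.map_smul]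
      simp only [form, QuadraticMap.polar_smul_right, QuadraticMap.polar_smul_left, hQe, hQu,
        hue0, hεv, smul_eq_mul]
      ring
    have hpres' : ∀ u v, (orthogonal Q nd).form (T u) (T v) = (orthogonal Q nd).form u v := by
      intro u v
      simp only [form, QuadraticMap.polar]
      rw [← map_add, hpres, hpres, hpres]
    refine ⟨LinearEquiv.ofInjectiveEndo T (injective_of_form_eq _ hpres' hrad), ?_, hTe, hTf,
      hfix⟩
    exact hpres
  | unitary conj inv nt B herm nd =>
    have hεv : ε = 1 := by
      rw [← hfe]
      have h1 : B e f = 1 := hef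
      exact (herm e f).trans (by rw [h1, map_one])
    have hBe : B e e = 0 := he
    have hBf : B f f = 0 := hf
    have heu0 : B e u = 0 := heu
    have hue0 : B u e = 0 := hue
    have hBu : B u u = -B f u - conj (B f u) := by
      have h : B (f + u) (f + u) = 0 := hf'
      rw [map_add B, LinearMap.add_apply, map_add (B f), map_add (B u), hBf, herm f u] at h
      linear_combination h
    have hpres : ∀ u v, B (T u) (T v) = B u v := fun z v => by
      simp only [hT, form, map_add, LinearMap.add_apply, map_smul, LinearMap.smul_apply, map_sub,
        LinearMap.sub_apply, LinearMap.map_smulₛₗ, hBe, heu0, hue0, hBu, smul_eq_mul,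
        RingHom.coe_coe, map_mul, map_one, herm v e, herm v u, hεv]
      ring
    refine ⟨LinearEquiv.ofInjectiveEndo T (injective_of_form_eq (unitary conj inv nt B herm nd) hpres hrad),
      ?_, hTe, hTf, hfix⟩
    exact hpres

end Generators

/-- A vector `u` not orthogonal to the singular vector `e` becomes singular after adding a
suitable multiple of `e`. -/
theorem exists_isSingularVector_add_smul (W : FormedSpace K V) {e u : V}
    (he : W.IsSingularVector e) (hu : W.form e u ≠ 0) :
    ∃ c : K, W.IsSingularVector (u + c • e) := by
  cases W with
  | symplectic B alt nd => exact ⟨0, trivial⟩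
  | orthogonal Q nd =>
    have hu' : QuadraticMap.polar Q e u ≠ 0 := hu
    have hQe : Q e = 0 := he
    refine ⟨-Q u / QuadraticMap.polar Q e u, ?_⟩
    simp only [IsSingularVector]
    rw [QuadraticMap.map_add Q, QuadraticMap.map_smul, QuadraticMap.polar_smul_right, hQe,
      QuadraticMap.polar_comm Q u e, smul_eq_mul, smul_eq_mul, div_mul_cancel₀ _ hu']
    simp
  | unitary conj inv nt B herm nd =>
    have hu' : B e u ≠ 0 := hu
    have hBe : B e e = 0 := he
    -- the trace `a + conj a` of the involution is not identically zero
    obtain ⟨a, ha⟩ : ∃ a : K, a + conj a ≠ 0 := by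
      by_contra! h
      obtain ⟨a, ha⟩ := nt
      have h1 := h 1
      have h2 := h a
      rw [map_one] at h1
      apply ha
      linear_combination h2 - a * h1
    have hcu : conj (B u u) = B u u := (herm u u).symm
    have hca : conj (a + conj a) = a + conj a := by rw [map_add, inv, add_comm]
    refine ⟨-B u u * (a / (a + conj a)) / B e u, ?_⟩
    simp only [IsSingularVector]
    simp only [map_add, LinearMap.add_apply, map_smul, LinearMap.smul_apply,
      LinearMap.map_smulₛₗ, smul_eq_mul, hBe, RingHom.coe_coe, map_mul, map_div₀, map_neg, hcu,
      herm e u, inv]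
    have hu'' : conj (B e u) ≠ 0 := by simpa using hu'
    have ha' : conj a + a ≠ 0 := by rwa [add_comm]
    field_simp
    ring

section Hyperbolic

variable (W : FormedSpace K V)

/-- The isometry group is transitive on hyperbolic pairs; the isometry can be chosen to fix
every vector orthogonal to both pairs. -/
theorem exists_isIsometry_hyperbolic_pair [FiniteDimensional K V] {e f e' f' : V}
    (he : W.IsSingularVector e) (hf : W.IsSingularVector f) (he' : W.IsSingularVector e')
    (hf' : W.IsSingularVector f')
    (hef : W.form e f = 1) (hef' : W.form e' f' = 1) :
    ∃ g : V ≃ₗ[K] V, W.IsIsometry g ∧ g e = e' ∧ g f = f' ∧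
      ∀ z, W.form z e = 0 → W.form z f = 0 → W.form z e' = 0 → W.form z f' = 0 → g z = z := by
  obtain ⟨g, hg, hge, hfix⟩ : ∃ g : V ≃ₗ[K] V, W.IsIsometry g ∧ g e = e' ∧
      ∀ z, W.form z e = 0 → W.form z f = 0 → W.form z e' = 0 → W.form z f' = 0 → g z = z := by
    by_cases hee' : W.form e e' = 0
    · -- pass through a singular vector orthogonal to neither `e` nor `e'`
      obtain ⟨u, hu, hu', hperp⟩ : ∃ u, W.form e u ≠ 0 ∧ W.form e' u ≠ 0 ∧
          ∀ z, W.form z f = 0 → W.form z f' = 0 → W.form z u = 0 := by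
        by_cases h1 : W.form e' f = 0
        · by_cases h2 : W.form e f' = 0
          · refine ⟨f + f', ?_, ?_, fun z h h' => by rw [form_add_right, h, h', add_zero]⟩
            · rw [form_add_right, hef, h2]; simp
            · rw [form_add_right, hef', h1]; simp
          · exact ⟨f', h2, by rw [hef']; simp, fun z _ h' => h'⟩
        · exact ⟨f, by rw [hef]; simp, h1, fun z h _ => h⟩
      obtain ⟨c, hc⟩ := W.exists_isSingularVector_add_smul he hu
      have h1 : W.form e (u + c • e) ≠ 0 := by
        rw [form_add_right, form_smul_right, he.form_self, mul_zero, add_zero]; exact hu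
      have h2 : W.form (u + c • e) e' ≠ 0 := by
        rw [form_add_left, form_smul_left, hee', mul_zero, add_zero]
        exact fun h => hu' (W.form_eq_zero_swap h)
      obtain ⟨g₁, hg₁, hg₁e, hfix₁⟩ := W.exists_isIsometry_of_form_ne_zero he hc h1
      obtain ⟨g₂, hg₂, hg₂e, hfix₂⟩ := W.exists_isIsometry_of_form_ne_zero hc he' h2
      refine ⟨g₁.trans g₂, hg₁.trans hg₂, by simp [hg₁e, hg₂e], fun z hz hz1 hz' hz2 => ?_⟩
      have h3 : W.form z (u + c • e) = 0 := by
        rw [form_add_right, form_smul_right, hz, hperp z hz1 hz2]; simp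
      rw [LinearEquiv.trans_apply, hfix₁ z hz h3, hfix₂ z h3 hz']
    · obtain ⟨g, hg, hge, hfix⟩ := W.exists_isIsometry_of_form_ne_zero he he' hee'
      exact ⟨g, hg, hge, fun z h _ h' _ => hfix z h h'⟩
  obtain ⟨g', hg', hge', hgf', hfix'⟩ := W.exists_isIsometry_fixing he'
    ((hg.isSingularVector_iff f).2 hf) hf' (by rw [← hge, hg.form_eq, hef]) hef'
  refine ⟨g.trans g', hg.trans hg', by simp [hge, hge'], by simp [hgf'], fun z h1 h2 h3 h4 => ?_⟩
  have h5 := hfix z h1 h2 h3 h4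
  rw [LinearEquiv.trans_apply, h5, hfix' z h3 (by rw [← h5, hg.form_eq, h2]) h4]

/-- The families `e, f` consist of pairwise orthogonal hyperbolic pairs `(e i, f i)`, where `f i`
is required only for `i ∈ D`. -/
structure IsHyperbolicFamily {ι : Type*} (D : Set ι) (e f : ι → V) : Prop where
  left_singular : ∀ i, W.IsSingularVector (e i)
  right_singular : ∀ i ∈ D, W.IsSingularVector (f i)
  form_left : ∀ i j, W.form (e i) (e j) = 0
  form_right : ∀ i ∈ D, ∀ j ∈ D, W.form (f i) (f j) = 0
  form_self : ∀ i ∈ D, W.form (e i) (f i) = 1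
  form_ne : ∀ i, ∀ j ∈ D, i ≠ j → W.form (e i) (f j) = 0

variable {W}

theorem IsHyperbolicFamily.map {ι : Type*} {D : Set ι} {e f : ι → V}
    (h : W.IsHyperbolicFamily D e f) {g : V ≃ₗ[K] V} (hg : W.IsIsometry g) :
    W.IsHyperbolicFamily D (g ∘ e) (g ∘ f) where
  left_singular i := (hg.isSingularVector_iff _).2 (h.left_singular i)
  right_singular i hi := (hg.isSingularVector_iff _).2 (h.right_singular i hi)
  form_left i j := (hg.form_eq _ _).trans (h.form_left i j)
  form_right i hi j hj := (hg.form_eq _ _).trans (h.form_right i hi j hj)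
  form_self i hi := (hg.form_eq _ _).trans (h.form_self i hi)
  form_ne i j hj hij := (hg.form_eq _ _).trans (h.form_ne i j hj hij)

/-- The isometry group is transitive on families of pairwise orthogonal hyperbolic pairs. -/
theorem IsHyperbolicFamily.exists_isIsometry [FiniteDimensional K V] {ι : Type*} [Finite ι]
    {e f e' f' : ι → V}
    (h : W.IsHyperbolicFamily Set.univ e f) (h' : W.IsHyperbolicFamily Set.univ e' f') :
    ∃ g : V ≃ₗ[K] V, W.IsIsometry g ∧ (∀ i, g (e i) = e' i) ∧ ∀ i, g (f i) = f' i := by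
  classical
  have := Fintype.ofFinite ι
  suffices H : ∀ s : Finset ι, ∃ g : V ≃ₗ[K] V, W.IsIsometry g ∧ ∀ i ∈ s, g (e i) = e' i ∧
      g (f i) = f' i by
    obtain ⟨g, hg, hgs⟩ := H Finset.univ
    exact ⟨g, hg, fun i => (hgs i (Finset.mem_univ i)).1, fun i => (hgs i (Finset.mem_univ i)).2⟩
  intro s
  induction s using Finset.induction_on with
  | empty => exact ⟨_, isIsometry_refl W, by simp⟩
  | insert a s ha ih =>
    obtain ⟨g, hg, hgs⟩ := ih
    have hm := h.map hg
    obtain ⟨g', hg', hge, hgf, hfix⟩ := W.exists_isIsometry_hyperbolic_pair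
      (hm.left_singular a) (hm.right_singular a trivial) (h'.left_singular a)
      (h'.right_singular a trivial) (hm.form_self a trivial) (h'.form_self a trivial)
    refine ⟨g.trans g', hg.trans hg', fun i hi => ?_⟩
    rcases Finset.mem_insert.1 hi with rfl | hi
    · exact ⟨hge, hgf⟩
    · have hia : i ≠ a := fun h => ha (h ▸ hi)
      obtain ⟨h1, h2⟩ := hgs i hi
      constructor
      · rw [LinearEquiv.trans_apply, ← h1]
        refine hfix _ (hm.form_left i a) (hm.form_ne i a trivial hia) ?_ ?_
        · rw [h1]; exact h'.form_left i a
        · rw [h1]; exact h'.form_ne i a trivial hia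
      · rw [LinearEquiv.trans_apply, ← h2]
        refine hfix _ (W.form_eq_zero_swap (hm.form_ne a i trivial hia.symm))
          (hm.form_right i trivial a trivial) ?_ ?_
        · rw [h2]; exact W.form_eq_zero_swap (h'.form_ne a i trivial hia.symm)
        · rw [h2]; exact h'.form_right i trivial a trivial

end Hyperbolic

end FormedSpace

/-! ### Completion of hyperbolic families and systems with the same relation -/

namespace FormedSpace

variable {K V : Type*} [Field K] [AddCommGroup V] [Module K V]

section Completion

variable {W : FormedSpace K V} {ι : Type*}

theorem isSingularVector_sum {s : Finset ι} {v : ι → V} (h : ∀ i, W.IsSingularVector (v i))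
    (h' : ∀ i j, W.form (v i) (v j) = 0) : W.IsSingularVector (∑ i ∈ s, v i) := by
  classical
  induction s using Finset.induction_on with
  | empty =>
    cases W with
    | symplectic B alt nd => trivial
    | orthogonal Q nd => simp [IsSingularVector]
    | unitary conj _ _ B herm nd => simp [IsSingularVector]
  | insert a s ha ih =>
    rw [Finset.sum_insert ha]
    refine (h a).add ih ?_
    rw [form_sum_right]
    exact Finset.sum_eq_zero fun i _ => h' a i

/-- Linearly independent, pairwise orthogonal singular vectors have dual vectors, because the
form has no singular vector in its radical. -/
theorem exists_dual_vector [Finite ι] {e : ι → V} (hsing : ∀ i, W.IsSingularVector (e i))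
    (hform : ∀ i j, W.form (e i) (e j) = 0) (he : LinearIndependent K e) (c : ι → K) :
    ∃ v, ∀ i, W.form v (e i) = c i := by
  classical
  have := Fintype.ofFinite ι
  let Φ : V →ₗ[K] (ι → K) := LinearMap.pi fun i => W.formLeft (e i)
  suffices h : LinearMap.range Φ = ⊤ by
    obtain ⟨v, hv⟩ := LinearMap.range_eq_top.1 h c
    exact ⟨v, fun i => congrFun hv i⟩
  by_contra hne
  obtain ⟨φ, hφ, hle⟩ := Submodule.exists_le_ker_of_lt_top _ (lt_top_iff_ne_top.2 hne)
  -- a functional that vanishes on the range gives a singular vector in the radical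
  have hsum : ∀ x : ι → K, φ x = ∑ i, x i * φ (Pi.single i 1) := fun x => by
    conv_lhs => rw [← Finset.univ_sum_single x, map_sum]
    refine Finset.sum_congr rfl fun i _ => ?_
    rw [← smul_eq_mul, ← map_smul, ← Pi.single_smul, smul_eq_mul, mul_one]
  have hz : ∑ i, W.twist (φ (Pi.single i 1)) • e i = 0 := by
    refine W.eq_zero_of_forall_form_eq_zero (fun u => ?_)
      (isSingularVector_sum (fun i => (hsing i).smul _) fun i j => by
        rw [form_smul_left, form_smul_right, hform]; simp)
    refine W.form_eq_zero_swap ?_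
    have h0 : φ (Φ u) = 0 := hle (LinearMap.mem_range_self Φ u)
    rw [hsum] at h0
    rw [form_sum_right, ← h0]
    refine Finset.sum_congr rfl fun i _ => ?_
    rw [form_smul_right, twist_twist, mul_comm]
    rfl
  have hc := Fintype.linearIndependent_iff.1 he _ hz
  apply hφ
  ext x
  have := hc x
  rw [map_eq_zero_iff _ (W.twist).injective] at this
  simpa using this

/-- A partial family of hyperbolic pairs whose first vectors are linearly independent can be
completed. -/
theorem IsHyperbolicFamily.exists_complete [Finite ι] {D : Set ι} {e f : ι → V}
    (h : W.IsHyperbolicFamily D e f) (he : LinearIndependent K e) :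
    ∃ f' : ι → V, (∀ i ∈ D, f' i = f i) ∧ W.IsHyperbolicFamily Set.univ e f' := by
  classical
  have := Fintype.ofFinite ι
  suffices H : ∀ s : Finset ι, ∃ f' : ι → V, (∀ i ∈ D, f' i = f i) ∧
      W.IsHyperbolicFamily (D ∪ s) e f' by
    obtain ⟨f', h1, h2⟩ := H Finset.univ
    exact ⟨f', h1, by simpa using h2⟩
  intro s
  induction s using Finset.induction_on with
  | empty => exact ⟨f, fun _ _ => rfl, by simpa using h⟩
  | insert a s ha ih =>
    obtain ⟨f', hf', hE⟩ := ih
    set E : Set ι := D ∪ s with hEdef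
    have hins : D ∪ ((insert a s : Finset ι) : Set ι) = insert a E := by
      rw [Finset.coe_insert, Set.union_insert]
    rw [hins]
    by_cases haE : a ∈ E
    · exact ⟨f', hf', by rwa [Set.insert_eq_of_mem haE]⟩
    obtain ⟨ε, hε, hεt, hsw⟩ := W.exists_form_swap
    obtain ⟨v, hv⟩ := exists_dual_vector hE.left_singular hE.form_left he (Pi.single a ε)
    have hva : W.form (e a) v = 1 := by
      rw [hsw, hv, Pi.single_eq_same, hεt, hε]
    have hvj : ∀ j, j ≠ a → W.form (e j) v = 0 := fun j hj => by
      rw [hsw, hv, Pi.single_eq_of_ne hj, map_zero, mul_zero]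
    set v' := v - ∑ j ∈ Finset.univ.filter (· ∈ E), W.twist (ε * W.form (f' j) v) • e j with hv'
    have hev' : ∀ j, W.form (e j) v' = W.form (e j) v := fun j => by
      rw [hv', form_sub_right, form_sum_right, Finset.sum_eq_zero, sub_zero]
      intro i _
      rw [form_smul_right, hE.form_left, mul_zero]
    have hfv' : ∀ j ∈ E, W.form (f' j) v' = 0 := fun j hj => by
      rw [hv', form_sub_right, form_sum_right, Finset.sum_eq_single j]
      · rw [form_smul_right, twist_twist, hsw (e j) (f' j), hE.form_self j hj, map_one]
        linear_combination (-W.form (f' j) v) * hε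
      · intro i _ hij
        rw [form_smul_right, W.form_eq_zero_swap (hE.form_ne i j hj hij), mul_zero]
      · simp [hj]
    obtain ⟨c, hc⟩ := W.exists_isSingularVector_add_smul (hE.left_singular a) (u := v')
      (by rw [hev', hva]; exact one_ne_zero)
    have hew : ∀ j, W.form (e j) (v' + c • e a) = W.form (e j) v := fun j => by
      rw [form_add_right, form_smul_right, hE.form_left, mul_zero, add_zero, hev']
    have hfw : ∀ j ∈ E, W.form (f' j) (v' + c • e a) = 0 := fun j hj => by
      rw [form_add_right, form_smul_right, hfv' j hj,
        W.form_eq_zero_swap (hE.form_ne a j hj fun h => haE (h ▸ hj)), mul_zero, add_zero]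
    have hne : ∀ j ∈ E, j ≠ a := fun j hj h => haE (h ▸ hj)
    refine ⟨Function.update f' a (v' + c • e a), fun i hi => ?_, hE.left_singular, ?_,
      hE.form_left, ?_, ?_, ?_⟩
    · rw [Function.update_of_ne (hne i (Or.inl hi)), hf' i hi]
    · rintro i (rfl | hi)
      · rwa [Function.update_self]
      · rw [Function.update_of_ne (hne i hi)]
        exact hE.right_singular i hi
    · rintro i (rfl | hi) j (rfl | hj)
      · rw [Function.update_self]
        exact hc.form_self
      · rw [Function.update_self, Function.update_of_ne (hne j hj)]
        exact W.form_eq_zero_swap (hfw j hj)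
      · rw [Function.update_self, Function.update_of_ne (hne i hi)]
        exact hfw i hi
      · rw [Function.update_of_ne (hne i hi), Function.update_of_ne (hne j hj)]
        exact hE.form_right i hi j hj
    · rintro i (rfl | hi)
      · rw [Function.update_self, hew, hva]
      · rw [Function.update_of_ne (hne i hi)]
        exact hE.form_self i hi
    · rintro i j (rfl | hj) hij
      · rw [Function.update_self, hew, hvj i hij]
      · rw [Function.update_of_ne (hne j hj)]
        exact hE.form_ne i j hj hij

end Completion

section Systems

variable {W : FormedSpace K V} {k m : ℕ} {M M' : VectorSystem V k m}
  {L L' : Fin (m + 1) → W.SingularSubspace k}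

theorem Induces.apply_zero (h : W.Induces M L) :
    (L 0).1 = Submodule.span K (Set.range M.x ∪ Set.range M.w) := by
  rw [h.2 0]
  congr 2
  ext v
  simp only [Set.mem_union, Set.mem_image, Set.mem_ofPred_eq, Set.mem_range, Fin.val_zero,
    add_zero]
  constructor
  · rintro (⟨j, -, rfl⟩ | ⟨j, hj, rfl⟩)
    · exact ⟨j, rfl⟩
    · omega
  · rintro ⟨j, rfl⟩
    exact Or.inl ⟨j, j.2, rfl⟩

theorem Induces.apply_last (h : W.Induces M L) :
    (L (Fin.last m)).1 = Submodule.span K (Set.range M.y ∪ Set.range M.w) := by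
  rw [h.2]
  congr 2
  ext v
  simp only [Set.mem_union, Set.mem_image, Set.mem_ofPred_eq, Set.mem_range, Fin.val_last]
  constructor
  · rintro (⟨j, hj, rfl⟩ | ⟨j, hj, rfl⟩)
    · omega
    · exact ⟨j, rfl⟩
  · rintro ⟨j, rfl⟩
    exact Or.inr ⟨j, by omega, rfl⟩

theorem Induces.x_mem (h : W.Induces M L) (i : Fin m) : M.x i ∈ (L 0).1 := by
  rw [h.apply_zero]
  exact Submodule.subset_span (Or.inl ⟨i, rfl⟩)

theorem Induces.y_mem (h : W.Induces M L) (i : Fin m) : M.y i ∈ (L (Fin.last m)).1 := by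
  rw [h.apply_last]
  exact Submodule.subset_span (Or.inl ⟨i, rfl⟩)

theorem Induces.w_mem_zero (h : W.Induces M L) (i : Fin (k - m)) : M.w i ∈ (L 0).1 := by
  rw [h.apply_zero]
  exact Submodule.subset_span (Or.inr ⟨i, rfl⟩)

theorem Induces.w_mem_last (h : W.Induces M L) (i : Fin (k - m)) :
    M.w i ∈ (L (Fin.last m)).1 := by
  rw [h.apply_last]
  exact Submodule.subset_span (Or.inr ⟨i, rfl⟩)

theorem SatisfiesR1.form_eq_zero (h : W.SatisfiesR1 M) {i j : Fin m}
    (hij : (i, j) ∉ W.relationOf M) : W.form (M.x i) (M.y j) = 0 := by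
  rcases h.1 i with h0 | ⟨i', -, h1, h0⟩
  · exact h0 j
  · refine h0 j ?_
    rintro rfl
    exact hij h1

theorem SatisfiesR1.lt (h : W.SatisfiesR1 M) {i j : Fin m}
    (hij : (i, j) ∈ W.relationOf M) : j < i := by
  have hij : W.form (M.x i) (M.y j) = 1 := hij
  rcases h.1 i with h0 | ⟨i', hi', h1, h0⟩
  · simp [h0 j] at hij
  · by_cases hj : j = i'
    · exact hj ▸ hi'
    · simp [h0 j hj] at hij

theorem SatisfiesR1.right_unique (h : W.SatisfiesR1 M) {i j j' : Fin m}
    (hij : (i, j) ∈ W.relationOf M) (hij' : (i, j') ∈ W.relationOf M) : j = j' := by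
  have hij : W.form (M.x i) (M.y j) = 1 := hij
  have hij' : W.form (M.x i) (M.y j') = 1 := hij'
  rcases h.1 i with h0 | ⟨i', hi', h1, h0⟩
  · simp [h0 j] at hij
  · by_contra hne
    by_cases hj : j = i'
    · simp [h0 j' (fun h => hne (hj.trans h.symm))] at hij'
    · simp [h0 j hj] at hij

theorem SatisfiesR1.left_unique (h : W.SatisfiesR1 M) {i i' j : Fin m}
    (hij : (i, j) ∈ W.relationOf M) (hij' : (i', j) ∈ W.relationOf M) : i = i' := by
  by_contra hne
  exact h.2 i i' j j hij hij' hne rfl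

/-- The first vectors of the hyperbolic family of a system with relation `ρ`: all `x_i`, the
`y_j` that `ρ` leaves unmatched, and all `w_j`. -/
def _root_.VectorSystem.left (M : VectorSystem V k m) (ρ : Set (Fin m × Fin m)) :
    Fin m ⊕ ({j : Fin m // ∀ i, (i, j) ∉ ρ} ⊕ Fin (k - m)) → V :=
  Sum.elim M.x (Sum.elim (fun j => M.y j) M.w)

open Classical in
/-- The second vectors of the hyperbolic family of a system with relation `ρ`: the partner
`y_{i'}` of `x_i` when `(i, i') ∈ ρ`. -/
noncomputable def _root_.VectorSystem.right (M : VectorSystem V k m) (ρ : Set (Fin m × Fin m)) :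
    Fin m ⊕ ({j : Fin m // ∀ i, (i, j) ∉ ρ} ⊕ Fin (k - m)) → V :=
  Sum.elim (fun i => if h : ∃ j, (i, j) ∈ ρ then M.y h.choose else 0) fun _ => 0

/-- The indices of the vectors that `ρ` matches. -/
def matchedIndices (k : ℕ) {m : ℕ} (ρ : Set (Fin m × Fin m)) :
    Set (Fin m ⊕ ({j : Fin m // ∀ i, (i, j) ∉ ρ} ⊕ Fin (k - m))) :=
  Sum.inl '' {i | ∃ j, (i, j) ∈ ρ}

theorem SatisfiesR1.right_apply (h : W.SatisfiesR1 M) {i j : Fin m}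
    (hij : (i, j) ∈ W.relationOf M) : M.right (W.relationOf M) (Sum.inl i) = M.y j := by
  have hex : ∃ j, (i, j) ∈ W.relationOf M := ⟨j, hij⟩
  simp only [VectorSystem.right, Sum.elim_inl, dif_pos hex]
  rw [h.right_unique hex.choose_spec hij]

theorem Induces.left_linearIndependent (h : W.Induces M L) (ρ : Set (Fin m × Fin m)) :
    LinearIndependent K (M.left ρ) := by
  have := h.1.comp (Sum.map id (Sum.map Subtype.val id))
    (Function.injective_id.sumMap
      ((Subtype.val_injective (p := fun j => ∀ i, (i, j) ∉ ρ)).sumMap Function.injective_id))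
  convert this using 1
  ext (i | i | i) <;> rfl

theorem Induces.isHyperbolicFamily (h : W.Induces M L) (hR : W.SatisfiesR1 M) :
    W.IsHyperbolicFamily (matchedIndices k (W.relationOf M)) (M.left (W.relationOf M))
      (M.right (W.relationOf M)) := by
  have h0 := (L 0).2.1
  have hm := (L (Fin.last m)).2.1
  have hxy : ∀ (i : Fin m) (j : {j : Fin m // ∀ i, (i, j) ∉ W.relationOf M}),
      W.form (M.x i) (M.y j) = 0 := fun i j => hR.form_eq_zero (j.2 i)
  refine ⟨?_, ?_, ?_, ?_, ?_, ?_⟩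
  · rintro (i | i | i)
    · exact h0.isSingularVector (h.x_mem i)
    · exact hm.isSingularVector (h.y_mem i)
    · exact h0.isSingularVector (h.w_mem_zero i)
  · rintro _ ⟨i, ⟨j, hij⟩, rfl⟩
    rw [hR.right_apply hij]
    exact hm.isSingularVector (h.y_mem j)
  · rintro (i | i | i) (j | j | j)
    · exact h0.form_eq_zero (h.x_mem i) (h.x_mem j)
    · exact hxy i j
    · exact h0.form_eq_zero (h.x_mem i) (h.w_mem_zero j)
    · exact W.form_eq_zero_swap (hxy j i)
    · exact hm.form_eq_zero (h.y_mem i) (h.y_mem j)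
    · exact hm.form_eq_zero (h.y_mem i) (h.w_mem_last j)
    · exact h0.form_eq_zero (h.w_mem_zero i) (h.x_mem j)
    · exact hm.form_eq_zero (h.w_mem_last i) (h.y_mem j)
    · exact h0.form_eq_zero (h.w_mem_zero i) (h.w_mem_zero j)
  · rintro _ ⟨i, ⟨j, hij⟩, rfl⟩ _ ⟨i', ⟨j', hij'⟩, rfl⟩
    rw [hR.right_apply hij, hR.right_apply hij']
    exact hm.form_eq_zero (h.y_mem j) (h.y_mem j')
  · rintro _ ⟨i, ⟨j, hij⟩, rfl⟩
    rw [hR.right_apply hij]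
    exact hij
  · rintro (i' | i' | i') _ ⟨i, ⟨j, hij⟩, rfl⟩ hne
    · rw [hR.right_apply hij]
      refine hR.form_eq_zero fun hi' => hne ?_
      rw [hR.left_unique hi' hij]
    · rw [hR.right_apply hij]
      exact hm.form_eq_zero (h.y_mem i') (h.y_mem j)
    · rw [hR.right_apply hij]
      exact hm.form_eq_zero (h.w_mem_last i') (h.y_mem j)

/-- The special case of Witt's theorem that is needed: two systems with the same relation (R1)
are conjugate under the isometry group. -/
theorem exists_isIsometry_of_relationOf_eq [FiniteDimensional K V] (h : W.Induces M L)
    (hR : W.SatisfiesR1 M) (h' : W.Induces M' L') (hR' : W.SatisfiesR1 M')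
    (hρ : W.relationOf M = W.relationOf M') :
    ∃ g : V ≃ₗ[K] V, W.IsIsometry g ∧ (∀ i, g (M.x i) = M'.x i) ∧ (∀ i, g (M.y i) = M'.y i) ∧
      ∀ i, g (M.w i) = M'.w i := by
  obtain ⟨f, hf, hF⟩ := (h.isHyperbolicFamily hR).exists_complete (h.left_linearIndependent _)
  have hH' := h'.isHyperbolicFamily hR'
  have hr' := fun {i j} => hR'.right_apply (i := i) (j := j)
  rw [← hρ] at hH' hr'
  obtain ⟨f', hf', hF'⟩ := hH'.exists_complete (h'.left_linearIndependent _)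
  obtain ⟨g, hg, hge, hgf⟩ := hF.exists_isIsometry hF'
  refine ⟨g, hg, fun i => hge (Sum.inl i), fun j => ?_, fun i => hge (Sum.inr (Sum.inr i))⟩
  by_cases hj : ∃ i, (i, j) ∈ W.relationOf M
  · obtain ⟨i, hij⟩ := hj
    have hi : Sum.inl i ∈ matchedIndices k (W.relationOf M) := ⟨i, ⟨j, hij⟩, rfl⟩
    have := hgf (Sum.inl i)
    rwa [hf _ hi, hf' _ hi, hR.right_apply hij, hr' hij] at this
  · push Not at hj
    exact hge (Sum.inr (Sum.inl ⟨j, hj⟩))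

end Systems

end FormedSpace

/-! ### Distances and geodesics in the polar Grassmann graph -/

section Submodule

variable {K V : Type*} [Field K] [AddCommGroup V] [Module K V] [FiniteDimensional K V]

theorem Submodule.exists_between_finrank_eq {A B : Submodule K V} (hAB : A ≤ B) {n : ℕ}
    (hA : finrank K A ≤ n) (hB : n ≤ finrank K B) :
    ∃ C : Submodule K V, A ≤ C ∧ C ≤ B ∧ finrank K C = n := by
  induction n, hA using Nat.le_induction with
  | base => exact ⟨A, le_rfl, hAB, rfl⟩
  | succ n hn ih =>
    obtain ⟨C, hAC, hCB, hC⟩ := ih (by omega)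
    obtain ⟨v, hvB, hvC⟩ : ∃ v ∈ B, v ∉ C := by
      by_contra! h
      have := Submodule.finrank_mono (R := K) (show B ≤ C from h)
      omega
    refine ⟨C ⊔ Submodule.span K {v}, hAC.trans le_sup_left,
      sup_le hCB ((Submodule.span_singleton_le_iff_mem _ _).2 hvB), ?_⟩
    rw [Submodule.finrank_sup_span_singleton hvC, hC]

theorem Submodule.finrank_inf_add_finrank_inf_le (A B C : Submodule K V) :
    finrank K (A ⊓ B : Submodule K V) + finrank K (B ⊓ C : Submodule K V) ≤
      finrank K B + finrank K (A ⊓ C : Submodule K V) := by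
  have h := Submodule.finrank_sup_add_finrank_inf_eq (A ⊓ B) (B ⊓ C)
  have h1 : finrank K (A ⊓ B ⊔ B ⊓ C : Submodule K V) ≤ finrank K B :=
    Submodule.finrank_mono (sup_le inf_le_right inf_le_left)
  have h2 : finrank K (A ⊓ B ⊓ (B ⊓ C) : Submodule K V) ≤ finrank K (A ⊓ C : Submodule K V) :=
    Submodule.finrank_mono (le_inf (inf_le_left.trans inf_le_left)
      (inf_le_right.trans inf_le_right))
  omega

end Submodule

namespace FormedSpace

variable {K V : Type*} [Field K] [AddCommGroup V] [Module K V]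

section Graph

variable {W : FormedSpace K V} {k m : ℕ}

theorem adj_iff (hk : k < W.wittIndex) {X Y : W.SingularSubspace k} :
    (W.polarGrassmannGraph k).Adj X Y ↔
      W.IsSingular (X.1 ⊔ Y.1) ∧ finrank K (X.1 ⊔ Y.1 : Submodule K V) = k + 1 := by
  simp only [polarGrassmannGraph]
  constructor
  · rintro (⟨h, -⟩ | ⟨-, h⟩)
    · omega
    · exact h
  · exact fun h => Or.inr ⟨hk, h⟩

/-- The vertices `X_0, …, X_m` of a geodesic, continued constantly to all indices. -/
def vertexSeq (L : Fin (m + 1) → W.SingularSubspace k) (i : ℕ) : W.SingularSubspace k :=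
  L ⟨min i m, by omega⟩

theorem vertexSeq_val (L : Fin (m + 1) → W.SingularSubspace k) (i : Fin (m + 1)) :
    vertexSeq L i = L i := by
  have : min (i : ℕ) m = i := by omega
  simp [vertexSeq, this]

theorem IsNonoppositeGeodesic.adj {L : Fin (m + 1) → W.SingularSubspace k}
    (h : W.IsNonoppositeGeodesic L) {i : ℕ} (hi : i < m) :
    (W.polarGrassmannGraph k).Adj (vertexSeq L i) (vertexSeq L (i + 1)) := by
  have := h.1.1 ⟨i, hi⟩
  rwa [← vertexSeq_val L, ← vertexSeq_val L] at this

theorem IsNonoppositeGeodesic.exists_walk {L : Fin (m + 1) → W.SingularSubspace k}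
    (h : W.IsNonoppositeGeodesic L) {i j : ℕ}
    (hij : i ≤ j) (hj : j ≤ m) :
    ∃ p : (W.polarGrassmannGraph k).Walk (vertexSeq L i) (vertexSeq L j),
      p.length + i = j := by
  induction j, hij using Nat.le_induction with
  | base => exact ⟨SimpleGraph.Walk.nil, by simp⟩
  | succ j hij ih =>
    obtain ⟨p, hp⟩ := ih (by omega)
    exact ⟨p.concat (h.adj hj), by rw [SimpleGraph.Walk.length_concat]; omega⟩

theorem IsNonoppositeGeodesic.le_perp (hk : k < W.wittIndex)
    {L : Fin (m + 1) → W.SingularSubspace k}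
    (h : W.IsNonoppositeGeodesic L) {i : ℕ} (hi : i < m) :
    (vertexSeq L (i + 1)).1 ≤ W.perp (vertexSeq L i).1 := fun _ hv _ hu =>
  ((adj_iff hk).1 (h.adj hi)).1.form_eq_zero (Submodule.mem_sup_left hu)
    (Submodule.mem_sup_right hv)

end Graph

variable [FiniteDimensional K V]

section PerpDim

variable {W : FormedSpace K V}

theorem finrank_inf_perp_le (W : FormedSpace K V) (X Y : Submodule K V) :
    finrank K X + finrank K (Y ⊓ W.perp X : Submodule K V) ≤
      finrank K Y + finrank K (X ⊓ W.perp Y : Submodule K V) := by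
  obtain ⟨C, hdisj, hsup⟩ := IsModularLattice.exists_disjoint_and_sup_eq
    (inf_le_left : Y ⊓ W.perp X ≤ Y)
  have hC := Submodule.finrank_sup_add_finrank_inf_eq (Y ⊓ W.perp X) C
  rw [hsup, hdisj.eq_bot, finrank_bot] at hC
  -- `X ∩ Y^⊥` is cut out of `X` by the functionals `B(·, c)` for a basis of `C`
  let b := finBasis K C
  let φ : X →ₗ[K] (Fin (finrank K C) → K) :=
    LinearMap.pi fun i => (W.formLeft (b i)).comp X.subtype
  have hφ := φ.finrank_range_add_finrank_ker
  have hr : finrank K (LinearMap.range φ) ≤ finrank K C := by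
    simpa using Submodule.finrank_le (LinearMap.range φ)
  have hk : finrank K (LinearMap.ker φ) ≤ finrank K (X ⊓ W.perp Y : Submodule K V) := by
    rw [← Submodule.finrank_map_subtype_eq X (LinearMap.ker φ)]
    refine Submodule.finrank_mono ?_
    rintro _ ⟨x, hx, rfl⟩
    refine ⟨x.2, W.mem_perp'.2 fun y hy => ?_⟩
    rw [← hsup] at hy
    obtain ⟨y₁, hy₁, c, hc, rfl⟩ := Submodule.mem_sup.1 hy
    rw [form_add_right, show W.form (X.subtype x) y₁ = 0 from hy₁.2 x x.2, zero_add]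
    have hbc := b.sum_repr ⟨c, hc⟩
    have hc' : c = ∑ i, b.repr ⟨c, hc⟩ i • (b i : V) := by
      simpa only [Submodule.coe_sum, Submodule.coe_smul] using (congrArg Subtype.val hbc).symm
    rw [hc', form_sum_right]
    refine Finset.sum_eq_zero fun i _ => ?_
    have : W.form x (b i) = 0 := congrFun (LinearMap.mem_ker.1 hx) i
    rw [form_smul_right, Submodule.subtype_apply, this, mul_zero]
  omega

/-- The pairing of `X` with `Y` has the same rank on both sides. -/
theorem finrank_inf_perp_comm (W : FormedSpace K V) (X Y : Submodule K V) :
    finrank K X + finrank K (Y ⊓ W.perp X : Submodule K V) =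
      finrank K Y + finrank K (X ⊓ W.perp Y : Submodule K V) :=
  le_antisymm (W.finrank_inf_perp_le X Y) (W.finrank_inf_perp_le Y X)

variable {k : ℕ}

theorem perpDim_add_finrank_inf (X Y : W.SingularSubspace k) :
    W.perpDim X Y + finrank K (X.1 ⊓ Y.1 : Submodule K V) =
      finrank K (X.1 ⊓ W.perp Y.1 : Submodule K V) := by
  have hle : X.1 ⊓ Y.1 ≤ X.1 ⊓ W.perp Y.1 := inf_le_inf_left _ Y.2.1.le_perp
  have h := Submodule.finrank_quotient_add_finrank
    ((X.1 ⊓ Y.1 : Submodule K V).submoduleOf (X.1 ⊓ W.perp Y.1))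
  rwa [(Submodule.submoduleOfEquivOfLe hle).finrank_eq] at h

theorem perpDim_comm (X Y : W.SingularSubspace k) : W.perpDim X Y = W.perpDim Y X := by
  have h1 := perpDim_add_finrank_inf X Y
  have h2 := perpDim_add_finrank_inf Y X
  have h3 := W.finrank_inf_perp_comm X.1 Y.1
  rw [X.2.2, Y.2.2] at h3
  rw [inf_comm Y.1 X.1] at h2
  omega

theorem perpDim_pos_iff {X Y : W.SingularSubspace k} :
    0 < W.perpDim X Y ↔ ¬ X.1 ⊓ W.perp Y.1 ≤ Y.1 := by
  have h1 := perpDim_add_finrank_inf X Y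
  have hle : X.1 ⊓ Y.1 ≤ X.1 ⊓ W.perp Y.1 := inf_le_inf_left _ Y.2.1.le_perp
  constructor
  · intro h h'
    have := Submodule.finrank_mono (le_inf inf_le_left h')
    omega
  · intro h
    have hlt : X.1 ⊓ Y.1 < X.1 ⊓ W.perp Y.1 := lt_of_le_of_ne hle fun he => h (by
      rw [← he]; exact inf_le_right)
    have := Submodule.finrank_lt_finrank_of_lt hlt
    omega

theorem perpDim_le {X Y : W.SingularSubspace k} {d : ℕ}
    (h : finrank K (X.1 ⊓ Y.1 : Submodule K V) + d = k) : W.perpDim X Y ≤ d := by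
  have h1 := perpDim_add_finrank_inf X Y
  have h2 : finrank K (X.1 ⊓ W.perp Y.1 : Submodule K V) ≤ finrank K X.1 :=
    Submodule.finrank_mono inf_le_left
  rw [X.2.2] at h2
  omega

/-- A vector of `X` is orthogonal to `Y ∩ X` anyway, so a witness against opposition lies in
`Y ∩ X^⊥` and outside `X`. -/
theorem perpDim_pos_of_not_opposite {X Y : W.SingularSubspace k} (hne : X ≠ Y)
    (h : ¬ W.Opposite X Y) : 0 < W.perpDim X Y := by
  rw [perpDim_comm, perpDim_pos_iff]
  intro hle
  refine h ⟨hne, fun y hy hyX => ?_⟩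
  by_contra! hall
  refine hyX (hle ⟨hy, fun x hx => ?_⟩)
  by_cases hxY : x ∈ Y.1
  · exact Y.2.1.form_eq_zero hxY hy
  · exact hall x hx hxY

end PerpDim

section Distance

variable {W : FormedSpace K V} {k : ℕ}

theorem finrank_inf_add_one_of_adj (hk : k < W.wittIndex) {X Y : W.SingularSubspace k}
    (h : (W.polarGrassmannGraph k).Adj X Y) :
    finrank K (X.1 ⊓ Y.1 : Submodule K V) + 1 = k := by
  have h1 := ((adj_iff hk).1 h).2
  have h2 := Submodule.finrank_sup_add_finrank_inf_eq X.1 Y.1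
  rw [h1, X.2.2, Y.2.2] at h2
  omega

theorem le_length_add_finrank_inf (hk : k < W.wittIndex) {X Y : W.SingularSubspace k}
    (p : (W.polarGrassmannGraph k).Walk X Y) :
    k ≤ p.length + finrank K (X.1 ⊓ Y.1 : Submodule K V) := by
  induction p with
  | @nil X => rw [inf_idem, X.2.2]; omega
  | @cons X Z Y h p ih =>
    have h1 := finrank_inf_add_one_of_adj hk h
    have h2 := Submodule.finrank_inf_add_finrank_inf_le X.1 Z.1 Y.1
    rw [Z.2.2] at h2
    rw [SimpleGraph.Walk.length_cons]
    omega

/-- A neighbour `F + G` of `X` on the way to `Y` is given by a hyperplane `F ⊇ X ∩ Y` of `X` and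
a subspace `G ⊆ Y ∩ X^⊥` that contains `X ∩ Y` as a hyperplane. -/
theorem exists_adj_of_hyperplane (hk : k < W.wittIndex) {X Y : W.SingularSubspace k}
    {F G : Submodule K V} (hF : X.1 ⊓ Y.1 ≤ F) (hFX : F ≤ X.1) (hFk : finrank K F + 1 = k)
    (hG : X.1 ⊓ Y.1 ≤ G) (hGY : G ≤ Y.1 ⊓ W.perp X.1)
    (hGk : finrank K G = finrank K (X.1 ⊓ Y.1 : Submodule K V) + 1) :
    ∃ Z : W.SingularSubspace k, Z.1 = F ⊔ G ∧ (W.polarGrassmannGraph k).Adj X Z ∧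
      Z.1 ⊓ X.1 = F ∧ Z.1 ⊓ Y.1 = G := by
  have hGY' : G ≤ Y.1 := hGY.trans inf_le_left
  have hXG : X.1 ⊓ G = X.1 ⊓ Y.1 := le_antisymm (inf_le_inf_left _ hGY') (le_inf inf_le_left hG)
  have hFG : F ⊓ G = X.1 ⊓ Y.1 :=
    le_antisymm (inf_le_inf hFX hGY') (le_inf hF hG)
  have hsing : W.IsSingular (X.1 ⊔ G) :=
    X.2.1.sup (Y.2.1.mono hGY') fun x hx y hy => (hGY hy).2 x hx
  have h1 := Submodule.finrank_sup_add_finrank_inf_eq F G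
  have h2 := Submodule.finrank_sup_add_finrank_inf_eq X.1 G
  rw [hFG] at h1
  rw [hXG, X.2.2] at h2
  let Z : W.SingularSubspace k := ⟨F ⊔ G, hsing.mono (sup_le_sup_right hFX _), by omega⟩
  have hXZ : X.1 ⊔ Z.1 = X.1 ⊔ G := by
    change X.1 ⊔ (F ⊔ G) = _
    rw [← sup_assoc, sup_eq_left.2 hFX]
  refine ⟨Z, rfl, (adj_iff hk).2 ?_, ?_, ?_⟩
  · rw [hXZ]
    exact ⟨hsing, by omega⟩
  · change (F ⊔ G) ⊓ X.1 = F
    rw [sup_inf_assoc_of_le G hFX, inf_comm, hXG, sup_eq_left.2 hF]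
  · change (F ⊔ G) ⊓ Y.1 = G
    rw [sup_comm, sup_inf_assoc_of_le F hGY']
    exact sup_eq_left.2 ((inf_le_inf_right _ hFX).trans hG)

/-- Vertices with `X ∩ Y^⊥ ≠ X ∩ Y` are joined by a path of length `k - dim (X ∩ Y)`. -/
theorem exists_walk_length_eq (hk : k < W.wittIndex) {d : ℕ} {X Y : W.SingularSubspace k}
    (hd : finrank K (X.1 ⊓ Y.1 : Submodule K V) + d = k) (hpos : 0 < W.perpDim X Y) :
    ∃ p : (W.polarGrassmannGraph k).Walk X Y, p.length = d := by
  induction d generalizing X with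
  | zero => have := perpDim_le hd; omega
  | succ d ih =>
    obtain ⟨x, hx, hxY⟩ := SetLike.not_le_iff_exists.1 (perpDim_pos_iff.1 hpos)
    obtain ⟨y, hy, hyX⟩ := SetLike.not_le_iff_exists.1
      (perpDim_pos_iff.1 (perpDim_comm X Y ▸ hpos))
    have hG : finrank K (X.1 ⊓ Y.1 ⊔ Submodule.span K {y} : Submodule K V) =
        finrank K (X.1 ⊓ Y.1 : Submodule K V) + 1 :=
      Submodule.finrank_sup_span_singleton fun h => hyX h.1
    have hGY : X.1 ⊓ Y.1 ⊔ Submodule.span K {y} ≤ Y.1 ⊓ W.perp X.1 :=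
      sup_le (le_inf inf_le_right (inf_le_left.trans X.2.1.le_perp))
        ((Submodule.span_singleton_le_iff_mem _ _).2 hy)
    rcases Nat.eq_zero_or_pos d with rfl | hdpos
    · -- `Y = (X ∩ Y) + ⟨y⟩` is adjacent to `X`
      have hY : X.1 ⊓ Y.1 ⊔ Submodule.span K {y} = Y.1 :=
        Submodule.eq_of_le_of_finrank_eq (hGY.trans inf_le_left) (by rw [hG, Y.2.2]; omega)
      rw [hY] at hGY
      have h2 := Submodule.finrank_sup_add_finrank_inf_eq X.1 Y.1
      rw [X.2.2, Y.2.2] at h2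
      have hadj : (W.polarGrassmannGraph k).Adj X Y := (adj_iff hk).2
        ⟨X.2.1.sup Y.2.1 fun x hx y hy => (hGY hy).2 x hx, by omega⟩
      exact ⟨hadj.toWalk, rfl⟩
    · -- the next vertex keeps `x`, so that it is again not opposite to `Y`
      have hA : finrank K (X.1 ⊓ Y.1 ⊔ Submodule.span K {x} : Submodule K V) =
          finrank K (X.1 ⊓ Y.1 : Submodule K V) + 1 :=
        Submodule.finrank_sup_span_singleton fun h => hxY h.2
      obtain ⟨F, hAF, hFX, hFk⟩ := Submodule.exists_between_finrank_eq (n := k - 1)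
        (sup_le inf_le_left ((Submodule.span_singleton_le_iff_mem _ _).2 hx.1) :
          X.1 ⊓ Y.1 ⊔ Submodule.span K {x} ≤ X.1) (by omega) (by rw [X.2.2]; omega)
      obtain ⟨Z, hZ, hadj, hZX, hZY⟩ := exists_adj_of_hyperplane hk (le_sup_left.trans hAF) hFX
        (by omega) le_sup_left hGY hG
      have hxZ : x ∈ Z.1 := by
        rw [hZ]
        exact Submodule.mem_sup_left
          (hAF (Submodule.mem_sup_right (Submodule.mem_span_singleton_self x)))
      obtain ⟨p, hp⟩ := ih (X := Z) (by rw [hZY, hG]; omega)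
        (perpDim_pos_iff.2 fun h => hxY (h ⟨hxZ, hx.2⟩))
      exact ⟨SimpleGraph.Walk.cons hadj p, by rw [SimpleGraph.Walk.length_cons, hp]⟩

theorem dist_eq_of_perpDim_pos (hk : k < W.wittIndex) {d : ℕ} {X Y : W.SingularSubspace k}
    (hd : finrank K (X.1 ⊓ Y.1 : Submodule K V) + d = k) (hpos : 0 < W.perpDim X Y) :
    (W.polarGrassmannGraph k).dist X Y = d := by
  obtain ⟨p, hp⟩ := exists_walk_length_eq hk hd hpos
  obtain ⟨q, hq⟩ := p.reachable.exists_walk_length_eq_dist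
  have h1 := SimpleGraph.dist_le p
  have h2 := le_length_add_finrank_inf hk q
  omega

end Distance

section Geodesic

variable {W : FormedSpace K V} {k m : ℕ} {L : Fin (m + 1) → W.SingularSubspace k}

theorem IsNonoppositeGeodesic.finrank_inf (hk : k < W.wittIndex) (hm : 1 ≤ m)
    (h : W.IsNonoppositeGeodesic L) {i j : ℕ} (hij : i ≤ j) (hj : j ≤ m) :
    finrank K ((vertexSeq L i).1 ⊓ (vertexSeq L j).1 : Submodule K V) + (j - i) = k := by
  have hle : ∀ {i j : ℕ}, i ≤ j → j ≤ m →
      k ≤ finrank K ((vertexSeq L i).1 ⊓ (vertexSeq L j).1 : Submodule K V) + (j - i) := by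
    intro i j hij hj
    obtain ⟨p, hp⟩ := h.exists_walk hij hj
    have := le_length_add_finrank_inf hk p
    omega
  have h0 : vertexSeq L 0 = L 0 := vertexSeq_val L 0
  have hlast : vertexSeq L m = L (Fin.last m) := vertexSeq_val L (Fin.last m)
  have hdist := h.1.2
  have hne : L 0 ≠ L (Fin.last m) := by
    intro he
    rw [he, SimpleGraph.dist_self] at hdist
    omega
  -- the intersection of the ends has dimension exactly `k - m`
  have hends : finrank K ((vertexSeq L 0).1 ⊓ (vertexSeq L m).1 : Submodule K V) + m = k := by
    have h1 : finrank K ((vertexSeq L 0).1 ⊓ (vertexSeq L m).1 : Submodule K V) ≤ k := by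
      conv_rhs => rw [← (vertexSeq L 0).2.2]
      exact Submodule.finrank_mono inf_le_left
    have h2 := dist_eq_of_perpDim_pos hk (X := vertexSeq L 0) (Y := vertexSeq L m)
      (d := k - finrank K ((vertexSeq L 0).1 ⊓ (vertexSeq L m).1 : Submodule K V)) (by omega)
      (by rw [h0, hlast]; exact perpDim_pos_of_not_opposite hne h.2)
    rw [h0, hlast, hdist] at h2
    rw [h0, hlast] at h1 ⊢
    omega
  have h1 := hle (Nat.zero_le i) (hij.trans hj)
  have h2 := hle hij hj
  have h3 := hle hj le_rfl
  have h4 := Submodule.finrank_inf_add_finrank_inf_le (vertexSeq L 0).1 (vertexSeq L i).1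
    (vertexSeq L j).1
  have h5 := Submodule.finrank_inf_add_finrank_inf_le (vertexSeq L 0).1 (vertexSeq L j).1
    (vertexSeq L m).1
  rw [(vertexSeq L i).2.2] at h4
  rw [(vertexSeq L j).2.2] at h5
  omega

theorem IsNonoppositeGeodesic.inf_le (hk : k < W.wittIndex) (hm : 1 ≤ m)
    (h : W.IsNonoppositeGeodesic L) {i j l : ℕ} (hij : i ≤ j) (hjl : j ≤ l) (hl : l ≤ m) :
    (vertexSeq L i).1 ⊓ (vertexSeq L l).1 ≤ (vertexSeq L j).1 := by
  have h1 := h.finrank_inf hk hm hij (hjl.trans hl)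
  have h2 := h.finrank_inf hk hm hjl hl
  have h3 := h.finrank_inf hk hm (hij.trans hjl) hl
  have h4 := Submodule.finrank_sup_add_finrank_inf_eq
    ((vertexSeq L i).1 ⊓ (vertexSeq L j).1) ((vertexSeq L j).1 ⊓ (vertexSeq L l).1)
  have h5 : finrank K ((vertexSeq L i).1 ⊓ (vertexSeq L j).1 ⊔
      (vertexSeq L j).1 ⊓ (vertexSeq L l).1 : Submodule K V) ≤ k := by
    conv_rhs => rw [← (vertexSeq L j).2.2]
    exact Submodule.finrank_mono (sup_le inf_le_right inf_le_left)
  have hle : (vertexSeq L i).1 ⊓ (vertexSeq L j).1 ⊓ ((vertexSeq L j).1 ⊓ (vertexSeq L l).1) ≤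
      (vertexSeq L i).1 ⊓ (vertexSeq L l).1 :=
    le_inf (inf_le_left.trans inf_le_left) (inf_le_right.trans inf_le_right)
  rw [← Submodule.eq_of_le_of_finrank_le hle (by omega)]
  exact inf_le_left.trans inf_le_right

theorem IsNonoppositeGeodesic.sup_inf_eq (hk : k < W.wittIndex) (hm : 1 ≤ m)
    (h : W.IsNonoppositeGeodesic L) {j : ℕ} (hj : j ≤ m) :
    (vertexSeq L 0).1 ⊓ (vertexSeq L j).1 ⊔ (vertexSeq L j).1 ⊓ (vertexSeq L m).1 =
      (vertexSeq L j).1 := by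
  refine Submodule.eq_of_le_of_finrank_le (sup_le inf_le_right inf_le_left) ?_
  have h1 := h.finrank_inf hk hm (Nat.zero_le j) hj
  have h2 := h.finrank_inf hk hm hj le_rfl
  have h3 := h.finrank_inf hk hm (Nat.zero_le m) le_rfl
  have h4 := Submodule.finrank_sup_add_finrank_inf_eq
    ((vertexSeq L 0).1 ⊓ (vertexSeq L j).1) ((vertexSeq L j).1 ⊓ (vertexSeq L m).1)
  have h5 : finrank K ((vertexSeq L 0).1 ⊓ (vertexSeq L j).1 ⊓
      ((vertexSeq L j).1 ⊓ (vertexSeq L m).1) : Submodule K V) ≤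
      finrank K ((vertexSeq L 0).1 ⊓ (vertexSeq L m).1 : Submodule K V) :=
    Submodule.finrank_mono
      (le_inf (inf_le_left.trans inf_le_left) (inf_le_right.trans inf_le_right))
  rw [(vertexSeq L j).2.2]
  omega

theorem IsNonoppositeGeodesic.perpDim_pos (hk : k < W.wittIndex) (hm : 1 ≤ m)
    (h : W.IsNonoppositeGeodesic L) {i j : ℕ} (hij : i < j) (hj : j ≤ m) :
    0 < W.perpDim (vertexSeq L i) (vertexSeq L j) := by
  rw [perpDim_comm, perpDim_pos_iff]
  intro hle
  have h1 := h.finrank_inf hk hm (Nat.succ_le_of_lt hij) hj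
  have h2 := h.finrank_inf hk hm hij.le hj
  have h3 : (vertexSeq L (i + 1)).1 ⊓ (vertexSeq L j).1 ≤
      (vertexSeq L i).1 ⊓ (vertexSeq L j).1 :=
    le_inf (fun v hv => hle ⟨hv.2, h.le_perp hk (by omega) hv.1⟩) inf_le_right
  have h4 := Submodule.finrank_mono h3
  rw [Nat.succ_eq_add_one] at h1
  omega

end Geodesic

end FormedSpace

/-! ### Normal form of a pair of flags -/

namespace FormedSpace

variable {K V : Type*} [Field K] [AddCommGroup V] [Module K V]

/-- Gaussian elimination for the pairing of two flags `A` (increasing) and `C` (decreasing), as in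
the Bruhat decomposition: bases `x`, `y` adapted to the flags can be changed, staying adapted, in
such a way that the first `n` rows of the matrix `B(x_i, y_j)` form a partial permutation matrix. -/
theorem exists_partial_permutation (W : FormedSpace K V) {m : ℕ} {A C : ℕ → Submodule K V}
    (hA : Monotone A) (hC : Antitone C) {x₀ y₀ : Fin m → V}
    (hx₀ : ∀ i : Fin m, x₀ i ∈ A (i + 1) ∧ x₀ i ∉ A i)
    (hy₀ : ∀ i : Fin m, y₀ i ∈ C i ∧ y₀ i ∉ C (i + 1)) {n : ℕ} (hn : n ≤ m) :
    ∃ x y : Fin m → V, (∀ i : Fin m, x i ∈ A (i + 1) ∧ x i ∉ A i) ∧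
      (∀ i : Fin m, y i ∈ C i ∧ y i ∉ C (i + 1)) ∧
      (∀ i : Fin m, (i : ℕ) < n → (∀ j, W.form (x i) (y j) = 0) ∨
        ∃ i', W.form (x i) (y i') = 1 ∧ ∀ j, j ≠ i' → W.form (x i) (y j) = 0) ∧
      ∀ i i' j : Fin m, (i : ℕ) < n → (i' : ℕ) < n → W.form (x i) (y j) ≠ 0 →
        W.form (x i') (y j) ≠ 0 → i = i' := by
  classical
  induction n with
  | zero => exact ⟨x₀, y₀, hx₀, hy₀, fun i hi => absurd hi (Nat.not_lt_zero _),
      fun i i' j hi => absurd hi (Nat.not_lt_zero _)⟩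
  | succ n ih =>
    obtain ⟨x, y, hx, hy, hrow, hcol⟩ := ih (by omega)
    set N : Fin m := ⟨n, hn⟩ with hN
    -- clear row `n` in the columns of the earlier pivots
    have hc : ∀ i : Fin m, ∃ c : K, (i : ℕ) < n → ∀ j, W.form (x i) (y j) ≠ 0 →
        W.form (x i) (y j) = 1 ∧ c = W.form (x N) (y j) := by
      intro i
      by_cases hi : (i : ℕ) < n
      · rcases hrow i hi with h0 | ⟨i', h1, h0⟩
        · exact ⟨0, fun _ j hj => absurd (h0 j) hj⟩
        · refine ⟨W.form (x N) (y i'), fun _ j hj => ?_⟩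
          obtain rfl : j = i' := by
            by_contra hne
            exact hj (h0 j hne)
          exact ⟨h1, rfl⟩
      · exact ⟨0, fun h => absurd h hi⟩
    choose c hc using hc
    set z := x N - ∑ i ∈ Finset.univ.filter (fun i : Fin m => (i : ℕ) < n), c i • x i with hz
    have hsum : ∑ i ∈ Finset.univ.filter (fun i : Fin m => (i : ℕ) < n), c i • x i ∈ A n := by
      refine Submodule.sum_mem _ fun i hi => Submodule.smul_mem _ _ ?_
      exact hA (Nat.succ_le_of_lt (Finset.mem_filter.1 hi).2) (hx i).1
    have hzA : z ∈ A (n + 1) := Submodule.sub_mem _ (hx N).1 (hA n.le_succ hsum)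
    have hzA' : z ∉ A n := fun h => (hx N).2 (by
      have := Submodule.add_mem _ h hsum
      rwa [hz, sub_add_cancel] at this)
    have hzy : ∀ i j : Fin m, (i : ℕ) < n → W.form (x i) (y j) ≠ 0 → W.form z (y j) = 0 := by
      intro i j hi hij
      rw [hz, form_sub_left, form_sum_left, Finset.sum_eq_single i]
      · rw [form_smul_left, (hc i hi j hij).1, ← (hc i hi j hij).2, mul_one, sub_self]
      · intro i' hi' hne
        rw [form_smul_left]
        by_contra h
        exact hne (hcol i' i j (Finset.mem_filter.1 hi').2 hi (fun h0 => h (by rw [h0, mul_zero]))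
          hij)
      · simp [hi]
    have hlt : ∀ i : Fin m, (i : ℕ) < n + 1 → (i : ℕ) < n ∨ i = N := fun i hi => by
      rcases Nat.lt_succ_iff_lt_or_eq.1 hi with h | h
      · exact Or.inl h
      · exact Or.inr (Fin.ext h)
    have hneN : ∀ i : Fin m, (i : ℕ) < n → i ≠ N := fun i hi h => by
      rw [h] at hi
      exact lt_irrefl _ hi
    by_cases hall : ∀ j, W.form z (y j) = 0
    · refine ⟨Function.update x N z, y, fun i => ?_, hy, fun i hi => ?_,
        fun i i' j hi hi' hij hij' => ?_⟩
      · by_cases hi : i = N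
        · rw [hi, Function.update_self]
          exact ⟨hzA, hzA'⟩
        · rw [Function.update_of_ne hi]
          exact hx i
      · rcases hlt i hi with hi | rfl
        · rw [Function.update_of_ne (hneN i hi)]
          exact hrow i hi
        · rw [Function.update_self]
          exact Or.inl hall
      · rcases hlt i hi with hi | rfl
        · rcases hlt i' hi' with hi' | rfl
          · rw [Function.update_of_ne (hneN i hi)] at hij
            rw [Function.update_of_ne (hneN i' hi')] at hij'
            exact hcol i i' j hi hi' hij hij'
          · rw [Function.update_self] at hij'
            exact absurd (hall j) hij'
        · rw [Function.update_self] at hij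
          exact absurd (hall j) hij
    -- the pivot is the last nonzero entry of the row; it clears the earlier columns
    obtain ⟨b, hb, hbmax⟩ : ∃ b, W.form z (y b) ≠ 0 ∧ ∀ l, b < l → W.form z (y l) = 0 := by
      push Not at hall
      obtain ⟨j, hj⟩ := hall
      obtain ⟨b, hb, hmax⟩ := (Finset.univ.filter fun j => W.form z (y j) ≠ 0).exists_max_image id
        ⟨j, by simpa using hj⟩
      refine ⟨b, (Finset.mem_filter.1 hb).2, fun l hl => ?_⟩
      by_contra h
      exact absurd (hmax l (by simpa using h)) (not_le.2 hl)
    set β := W.form z (y b) with hβ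
    have hxb : ∀ i : Fin m, (i : ℕ) < n → W.form (x i) (y b) = 0 := fun i hi => by
      by_contra h
      exact hb (hzy i b hi h)
    set z' := β⁻¹ • z with hz'
    have hz'b : W.form z' (y b) = 1 := by
      rw [hz', form_smul_left, ← hβ, inv_mul_cancel₀ hb]
    set y' : Fin m → V := fun l => if l = b then y b else
      y l - W.twist (W.form z' (y l)) • y b with hy'
    have hy'b : y' b = y b := if_pos rfl
    have hy'l : ∀ l, l ≠ b → y' l = y l - W.twist (W.form z' (y l)) • y b := fun l hl => if_neg hl
    have hz'y' : ∀ l, l ≠ b → W.form z' (y' l) = 0 := fun l hl => by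
      rw [hy'l l hl, form_sub_right, form_smul_right, twist_twist, hz'b, mul_one, sub_self]
    have hxy' : ∀ i l : Fin m, (i : ℕ) < n → W.form (x i) (y' l) = W.form (x i) (y l) := by
      intro i l hi
      by_cases hl : l = b
      · rw [hl, hy'b]
      · rw [hy'l l hl, form_sub_right, form_smul_right, hxb i hi, mul_zero, sub_zero]
    refine ⟨Function.update x N z', y', fun i => ?_, fun l => ?_, fun i hi => ?_,
      fun i i' j hi hi' hij hij' => ?_⟩
    · by_cases hi : i = N
      · rw [hi, Function.update_self]
        refine ⟨Submodule.smul_mem _ _ hzA, fun h => hzA' ?_⟩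
        exact (Submodule.smul_mem_iff _ (inv_ne_zero hb)).1 h
      · rw [Function.update_of_ne hi]
        exact hx i
    · rcases lt_trichotomy l b with hl | rfl | hl
      · have hb' : W.twist (W.form z' (y l)) • y b ∈ C (l + 1) :=
          Submodule.smul_mem _ _ (hC (Nat.succ_le_of_lt hl) (hy b).1)
        rw [hy'l l hl.ne]
        refine ⟨Submodule.sub_mem _ (hy l).1 (hC (Nat.le_succ _) hb'), fun h => (hy l).2 ?_⟩
        have := Submodule.add_mem _ h hb'
        rwa [sub_add_cancel] at this
      · rw [hy'b]
        exact hy l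
      · have : W.form z' (y l) = 0 := by rw [hz', form_smul_left, hbmax l hl, mul_zero]
        rw [hy'l l hl.ne', this, map_zero, zero_smul, sub_zero]
        exact hy l
    · rcases hlt i hi with hi | rfl
      · rw [Function.update_of_ne (hneN i hi)]
        simp only [hxy' i _ hi]
        exact hrow i hi
      · rw [Function.update_self]
        exact Or.inr ⟨b, by rw [hy'b, hz'b], hz'y'⟩
    · have hnb : ∀ j, W.form z' (y' j) ≠ 0 → j = b := fun j hj => by
        by_contra h
        exact hj (hz'y' j h)
      rcases hlt i hi with hi | rfl
      · rw [Function.update_of_ne (hneN i hi), hxy' i _ hi] at hij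
        rcases hlt i' hi' with hi' | rfl
        · rw [Function.update_of_ne (hneN i' hi'), hxy' i' _ hi'] at hij'
          exact hcol i i' j hi hi' hij hij'
        · rw [Function.update_self] at hij'
          obtain rfl := hnb j hij'
          exact absurd (hxb i hi) hij
      · rw [Function.update_self] at hij
        obtain rfl := hnb j hij
        rcases hlt i' hi' with hi' | rfl
        · rw [Function.update_of_ne (hneN i' hi'), hxy' i' _ hi'] at hij'
          exact absurd (hxb i' hi') hij'
        · rfl

variable [FiniteDimensional K V] {W : FormedSpace K V} {k m : ℕ}
  {L : Fin (m + 1) → W.SingularSubspace k}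

/-- Every geodesic with non-opposite ends is induced by a system that satisfies (R1). The `x_i`
are adapted to the flag of the `X_0 ∩ X_j` and the `y_i` to the flag of the `X_m ∩ X_j`. -/
theorem IsNonoppositeGeodesic.exists_system (hk : k < W.wittIndex) (hm : 1 ≤ m)
    (h : W.IsNonoppositeGeodesic L) :
    ∃ M : VectorSystem V k m, W.Induces M L ∧ W.SatisfiesR1 M := by
  classical
  set X : ℕ → Submodule K V := fun i => (vertexSeq L i).1 with hX
  set A : ℕ → Submodule K V := fun p => X 0 ⊓ X (m - p) with hAdef
  set C : ℕ → Submodule K V := fun l => X (m - l) ⊓ X m with hCdef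
  have hA : Monotone A := fun p q hpq =>
    le_inf inf_le_left (h.inf_le hk hm (Nat.zero_le _) (by omega) (Nat.sub_le m p))
  have hC : Antitone C := fun p q hpq =>
    le_inf (h.inf_le hk hm (by omega) (Nat.sub_le m p) le_rfl) inf_le_right
  have hAr : ∀ p, p ≤ m → finrank K (A p) + (m - p) = k := fun p hp =>
    h.finrank_inf hk hm (Nat.zero_le _) (Nat.sub_le m p)
  have hCr : ∀ l, l ≤ m → finrank K (C l) + l = k := fun l hl => by
    have := h.finrank_inf hk hm (Nat.sub_le m l) le_rfl
    rwa [Nat.sub_sub_self hl] at this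
  have hAC : A 0 = C m := by simp [hAdef, hCdef]
  have hx₀ : ∀ i : Fin m, ∃ v, v ∈ A (i + 1) ∧ v ∉ A i := fun i => by
    by_contra! hle
    have h1 := Submodule.finrank_mono (R := K) (show A (i + 1) ≤ A i from hle)
    have h2 := hAr i (by omega)
    have h3 := hAr (i + 1) (by omega)
    omega
  have hy₀ : ∀ i : Fin m, ∃ v, v ∈ C i ∧ v ∉ C (i + 1) := fun i => by
    by_contra! hle
    have h1 := Submodule.finrank_mono (R := K) (show C i ≤ C (i + 1) from hle)
    have h2 := hCr i (by omega)
    have h3 := hCr (i + 1) (by omega)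
    omega
  choose x₀ hx₀ using hx₀
  choose y₀ hy₀ using hy₀
  obtain ⟨x, y, hx, hy, hrow, hcol⟩ := W.exists_partial_permutation hA hC hx₀ hy₀ le_rfl
  have hdim : finrank K (A 0) = k - m := by have := hAr 0 (by omega); omega
  let b := finBasisOfFinrankEq K (A 0) hdim
  let w : Fin (k - m) → V := fun i => b i
  have hw : Submodule.span K (Set.range w) = A 0 := by
    have : Set.range w = (A 0).subtype '' Set.range b := by
      rw [← Set.range_comp]; rfl
    rw [this, Submodule.span_image, b.span_eq, Submodule.map_top, Submodule.range_subtype]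
  have hAspan : ∀ p, p ≤ m →
      A p = Submodule.span K (x '' {j | (j : ℕ) < p}) ⊔ Submodule.span K (Set.range w) := by
    intro p hp
    induction p with
    | zero => simp [hw]
    | succ p ih =>
      have hset : {j : Fin m | (j : ℕ) < p + 1} = insert ⟨p, hp⟩ {j : Fin m | (j : ℕ) < p} := by
        ext j
        simp only [Set.mem_ofPred_eq, Set.mem_insert_iff, Fin.ext_iff]
        omega
      rw [hset, Set.image_insert_eq, Submodule.span_insert, sup_assoc, ← ih (by omega), sup_comm]
      refine (Submodule.eq_of_le_of_finrank_eq (sup_le (hA p.le_succ)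
        ((Submodule.span_singleton_le_iff_mem _ _).2 (hx ⟨p, hp⟩).1)) ?_).symm
      rw [Submodule.finrank_sup_span_singleton (hx ⟨p, hp⟩).2]
      change finrank K (A p) + 1 = finrank K (A (p + 1))
      have h1 := hAr p (by omega)
      have h2 := hAr (p + 1) hp
      omega
  have hCspan : ∀ l, l ≤ m →
      C l = Submodule.span K (y '' {j | l ≤ (j : ℕ)}) ⊔ Submodule.span K (Set.range w) := by
    intro l hl
    induction hl using Nat.decreasingInduction with
    | self =>
      have hset : {j : Fin m | m ≤ (j : ℕ)} = ∅ := by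
        ext j
        simp
      rw [hset, hw, hAC]
      simp
    | of_succ l hl ih =>
      have hset : {j : Fin m | l ≤ (j : ℕ)} = insert ⟨l, hl⟩ {j : Fin m | l + 1 ≤ (j : ℕ)} := by
        ext j
        simp only [Set.mem_ofPred_eq, Set.mem_insert_iff, Fin.ext_iff]
        omega
      rw [hset, Set.image_insert_eq, Submodule.span_insert, sup_assoc, ← ih, sup_comm]
      refine (Submodule.eq_of_le_of_finrank_eq (sup_le (hC l.le_succ)
        ((Submodule.span_singleton_le_iff_mem _ _).2 (hy ⟨l, hl⟩).1)) ?_).symm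
      rw [Submodule.finrank_sup_span_singleton (hy ⟨l, hl⟩).2]
      change finrank K (C (l + 1)) + 1 = finrank K (C l)
      have h1 := hCr l (by omega)
      have h2 := hCr (l + 1) hl
      omega
  have hm0 := hAr 0 (by omega)
  refine ⟨⟨x, y, w⟩, ⟨?_, fun i => ?_⟩, fun i => ?_, fun i j i' j' hi hj hij => ?_⟩
  · rw [linearIndependent_iff_card_le_finrank_span]
    have hspan : Submodule.span K (Set.range (Sum.elim x (Sum.elim y w))) = X 0 ⊔ X m := by
      have h0 := hAspan m le_rfl
      have h1 := hCspan 0 (Nat.zero_le m)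
      have hs0 : {j : Fin m | (j : ℕ) < m} = Set.univ := by ext j; simp
      have hs1 : {j : Fin m | 0 ≤ (j : ℕ)} = Set.univ := by ext j; simp
      rw [hs0, Set.image_univ] at h0
      rw [hs1, Set.image_univ] at h1
      simp only [hAdef, hCdef, Nat.sub_self, Nat.sub_zero, inf_idem] at h0 h1
      rw [h0, h1, Set.Sum.elim_range, Set.Sum.elim_range, Submodule.span_union,
        Submodule.span_union, sup_sup_sup_comm, sup_idem, sup_assoc]
    have h2 := Submodule.finrank_sup_add_finrank_inf_eq (X 0) (X m)
    have h3 := h.finrank_inf hk hm (Nat.zero_le m) le_rfl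
    rw [show finrank K (X 0) = k from (vertexSeq L 0).2.2,
      show finrank K (X m) = k from (vertexSeq L m).2.2] at h2
    have h4 : finrank K (X 0 ⊓ X m : Submodule K V) + (m - 0) = k := h3
    rw [Set.finrank, hspan]
    simp only [Fintype.card_sum, Fintype.card_fin]
    omega
  · have h1 := h.sup_inf_eq hk hm (j := i) (by omega)
    have h2 := hAspan (m - i) (by omega)
    have h3 := hCspan (m - i) (by omega)
    have hmi : m - (m - i) = (i : ℕ) := by omega
    simp only [hAdef, hCdef, hmi] at h2 h3
    change X 0 ⊓ X i ⊔ X i ⊓ X m = X i at h1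
    rw [h2, h3, sup_sup_sup_comm, sup_idem] at h1
    rw [← vertexSeq_val L i]
    change X i = _
    have hs1 : {j : Fin m | (j : ℕ) + i < m} = {j : Fin m | (j : ℕ) < m - i} := by
      ext j
      simp only [Set.mem_ofPred_eq]
      omega
    have hs2 : {j : Fin m | m ≤ (j : ℕ) + i} = {j : Fin m | m - i ≤ (j : ℕ)} := by
      ext j
      simp only [Set.mem_ofPred_eq]
      omega
    rw [← h1, hs1, hs2, Submodule.span_union, Submodule.span_union]
  · -- the entries on and above the diagonal vanish because consecutive vertices are orthogonal
    have hzero : ∀ j, i ≤ j → W.form (x i) (y j) = 0 := fun j hij => by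
      have hxi : x i ∈ X (m - (i + 1)) := (hx i).1.2
      have hyj : y j ∈ X (m - i) := (hC hij (hy j).1).1
      have hperp := h.le_perp hk (i := m - (i + 1)) (by omega)
      rw [show m - (i + 1) + 1 = m - (i : ℕ) by omega] at hperp
      exact hperp hyj _ hxi
    rcases hrow i i.2 with h0 | ⟨i', h1, h0⟩
    · exact Or.inl h0
    · refine Or.inr ⟨i', ?_, h1, h0⟩
      by_contra hle
      exact one_ne_zero (h1.symm.trans (hzero i' (not_lt.1 hle)))
  · rintro rfl
    have hi : W.form (x i) (y i') = 1 := hi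
    have hj : W.form (x j) (y i') = 1 := hj
    exact hij (hcol i j i' i.2 j.2 (by rw [hi]; exact one_ne_zero) (by rw [hj]; exact one_ne_zero))

end FormedSpace

/-! ### The dimensions of `(X ∩ Y^⊥) / (X ∩ Y)` and the relation -/

namespace FormedSpace

variable {K V : Type*} [Field K] [AddCommGroup V] [Module K V] [FiniteDimensional K V]
  {W : FormedSpace K V} {k m : ℕ} {M M' : VectorSystem V k m}
  {L L' : Fin (m + 1) → W.SingularSubspace k}

/-- The number of ones of the relation `ρ`, seen as a partial permutation matrix, in the rows
`< p` and the columns `≥ q`. -/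
noncomputable def cornerRank (ρ : Set (Fin m × Fin m)) (p q : ℕ) : ℕ :=
  {n : Fin m × Fin m | n ∈ ρ ∧ (n.1 : ℕ) < p ∧ q ≤ (n.2 : ℕ)}.ncard

/-- The pairing of `X_i` with `X_j` has the rank of a corner of the matrix `ρ`. -/
theorem Induces.finrank_inf_perp (h : W.Induces M L) (hR : W.SatisfiesR1 M) {i j : Fin (m + 1)}
    (hij : i ≤ j) :
    finrank K ((L i).1 ⊓ W.perp (L j).1 : Submodule K V) +
      cornerRank (W.relationOf M) (m - i) (m - j) = k := by
  classical
  have hij' : (i : ℕ) ≤ j := hij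
  let N := {n : Fin m × Fin m // n ∈ W.relationOf M ∧ (n.1 : ℕ) < m - i ∧ m - j ≤ (n.2 : ℕ)}
  have := Fintype.ofFinite N
  have hx : ∀ a : Fin m, (a : ℕ) + i < m → M.x a ∈ (L i).1 := fun a ha => by
    rw [h.2 i]
    exact Submodule.subset_span (Or.inl (Or.inl ⟨a, ha, rfl⟩))
  have hw : ∀ a, M.w a ∈ (L i).1 := fun a => by
    rw [h.2 i]
    exact Submodule.subset_span (Or.inr ⟨a, rfl⟩)
  have hyj : ∀ a : Fin m, m ≤ (a : ℕ) + j → M.y a ∈ (L j).1 := fun a ha => by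
    rw [h.2 j]
    exact Submodule.subset_span (Or.inl (Or.inr ⟨a, ha, rfl⟩))
  -- a column of the corner without a one vanishes on `X_i`
  have hcol : ∀ b : Fin m, (¬ ∃ a : Fin m, (a, b) ∈ W.relationOf M ∧ (a : ℕ) < m - i) →
      ∀ v ∈ (L i).1, W.form v (M.y b) = 0 := by
    intro b hex v hv
    rw [h.2 i] at hv
    induction hv using Submodule.span_induction with
    | zero => exact W.form_zero_left _
    | add u u' _ _ h1 h2 => rw [form_add_left, h1, h2, add_zero]
    | smul c u _ h1 => rw [form_smul_left, h1, mul_zero]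
    | mem u hu =>
      rcases hu with (⟨a, ha, rfl⟩ | ⟨a, ha, rfl⟩) | ⟨a, rfl⟩
      · rw [Set.mem_ofPred_eq] at ha
        exact hR.form_eq_zero fun hmem => hex ⟨a, hmem, by omega⟩
      · exact (L (Fin.last m)).2.1.form_eq_zero (h.y_mem a) (h.y_mem b)
      · exact (L (Fin.last m)).2.1.form_eq_zero (h.w_mem_last a) (h.y_mem b)
  let φ : (L i).1 →ₗ[K] (N → K) :=
    LinearMap.pi fun n => (W.formLeft (M.y n.1.2)).comp (L i).1.subtype
  have hrange : LinearMap.range φ = ⊤ := by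
    rw [LinearMap.range_eq_top]
    intro c
    refine ⟨∑ n : N, c n • ⟨M.x n.1.1, hx _ (by have := n.2.2.1; omega)⟩, ?_⟩
    ext n'
    rw [map_sum, Finset.sum_apply, Finset.sum_eq_single n']
    · have h1 : W.form (M.x n'.1.1) (M.y n'.1.2) = 1 := n'.2.1
      simp [φ, h1]
    · intro n _ hne
      have h0 : W.form (M.x n.1.1) (M.y n'.1.2) = 0 := hR.form_eq_zero fun hmem => hne (by
        have h1 := hR.left_unique hmem n'.2.1
        have h2 := hR.right_unique hmem n.2.1
        exact Subtype.ext (Prod.ext h1 h2.symm))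
      simp [φ, h0]
    · simp
  have hker : (LinearMap.ker φ).map (L i).1.subtype = (L i).1 ⊓ W.perp (L j).1 := by
    apply le_antisymm
    · rintro _ ⟨v, hv, rfl⟩
      refine ⟨v.2, W.mem_perp'.2 fun u hu => ?_⟩
      rw [Submodule.subtype_apply]
      have hsing : ∀ u ∈ (L i).1, W.form v u = 0 := fun u hu => (L i).2.1.form_eq_zero v.2 hu
      rw [h.2 j] at hu
      induction hu using Submodule.span_induction with
      | zero => exact W.form_zero_right _
      | add u u' _ _ h1 h2 => rw [form_add_right, h1, h2, add_zero]
      | smul c u _ h1 => rw [form_smul_right, h1, mul_zero]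
      | mem u hu =>
        rcases hu with (⟨a, ha, rfl⟩ | ⟨b, hb, rfl⟩) | ⟨a, rfl⟩
        · rw [Set.mem_ofPred_eq] at ha
          exact hsing _ (hx a (by omega))
        · rw [Set.mem_ofPred_eq] at hb
          by_cases hex : ∃ a : Fin m, (a, b) ∈ W.relationOf M ∧ (a : ℕ) < m - i
          · obtain ⟨a, hab, ha⟩ := hex
            exact congrFun (LinearMap.mem_ker.1 hv) ⟨(a, b), hab, ha, by dsimp only; omega⟩
          · exact hcol b hex v v.2
        · exact hsing _ (hw a)
    · rintro v ⟨hv, hv'⟩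
      refine ⟨⟨v, hv⟩, LinearMap.mem_ker.2 (funext fun n => ?_), rfl⟩
      exact W.mem_perp'.1 hv' _ (hyj _ (by have := n.2.2.2; omega))
  have hφ := φ.finrank_range_add_finrank_ker
  rw [hrange, finrank_top, Module.finrank_fintype_fun_eq_card, (L i).2.2,
    ← Submodule.finrank_map_subtype_eq, hker, ← Nat.card_eq_fintype_card] at hφ
  have hN : cornerRank (W.relationOf M) (m - i) (m - j) = Nat.card N := rfl
  rw [hN]
  omega

theorem IsNonoppositeGeodesic.perpDim_add_cornerRank (hk : k < W.wittIndex) (hm : 1 ≤ m)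
    (hL : W.IsNonoppositeGeodesic L) (h : W.Induces M L) (hR : W.SatisfiesR1 M)
    {i j : Fin (m + 1)} (hij : i ≤ j) :
    W.perpDim (L i) (L j) + cornerRank (W.relationOf M) (m - i) (m - j) = j - i := by
  have h1 := h.finrank_inf_perp hR hij
  have h2 := perpDim_add_finrank_inf (L i) (L j)
  have h3 := hL.finrank_inf hk hm (i := i) (j := j) hij (by omega)
  rw [vertexSeq_val, vertexSeq_val] at h3
  omega

theorem cornerRank_eq_add_one {ρ ρ' : Set (Fin m × Fin m)} {a b : Fin m}
    (hagree : ∀ i < a, ∀ j, (i, j) ∈ ρ ↔ (i, j) ∈ ρ') (hab : (a, b) ∈ ρ)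
    (huniq : ∀ c, (a, c) ∈ ρ → c = b) (hρ' : ∀ c, (a, c) ∈ ρ' → c < b) :
    cornerRank ρ (a + 1) b = cornerRank ρ' (a + 1) b + 1 := by
  have hset : {n : Fin m × Fin m | n ∈ ρ ∧ (n.1 : ℕ) < a + 1 ∧ (b : ℕ) ≤ n.2} =
      insert (a, b) {n : Fin m × Fin m | n ∈ ρ' ∧ (n.1 : ℕ) < a + 1 ∧ (b : ℕ) ≤ n.2} := by
    ext ⟨i, j⟩
    simp only [Set.mem_ofPred_eq, Set.mem_insert_iff, Prod.mk.injEq]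
    rcases lt_trichotomy i a with hi | rfl | hi
    · simp [hagree i hi j, hi.ne]
    · constructor
      · rintro ⟨h1, -, -⟩
        exact Or.inl ⟨rfl, huniq j h1⟩
      · rintro (⟨-, rfl⟩ | ⟨h1, -, h3⟩)
        · exact ⟨hab, Nat.lt_succ_self _, le_rfl⟩
        · exact absurd (hρ' j h1) (not_lt.2 h3)
    · have h1 : ¬ (i : ℕ) < a + 1 := by
        have : (a : ℕ) < i := hi
        omega
      simp [h1, hi.ne']
  rw [cornerRank, hset, Set.ncard_insert_of_notMem, cornerRank]
  rintro ⟨h1, -, -⟩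
  exact lt_irrefl _ (hρ' b h1)

/-- At the first row where the relations differ, one entry of the table of the dimensions
`dim (X_i ∩ X_j^⊥) / (X_i ∩ X_j)` tells them apart. -/
theorem IsNonoppositeGeodesic.perpDim_add_one_eq (hk : k < W.wittIndex) (hm : 1 ≤ m)
    (hL : W.IsNonoppositeGeodesic L) (hL' : W.IsNonoppositeGeodesic L')
    (h : W.Induces M L) (hR : W.SatisfiesR1 M) (h' : W.Induces M' L') (hR' : W.SatisfiesR1 M')
    {a b : Fin m} (hagree : ∀ i < a, ∀ j, (i, j) ∈ W.relationOf M ↔ (i, j) ∈ W.relationOf M')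
    (hab : (a, b) ∈ W.relationOf M) (hρ' : ∀ c, (a, c) ∈ W.relationOf M' → c < b) :
    W.perpDim (L a.rev.castSucc) (L b.rev.succ) + 1 =
      W.perpDim (L' a.rev.castSucc) (L' b.rev.succ) := by
  have hba : (b : ℕ) < a := hR.lt hab
  have hc := cornerRank_eq_add_one hagree hab (fun c hc => hR.right_unique hc hab) hρ'
  have hle : a.rev.castSucc ≤ b.rev.succ := by
    rw [Fin.le_def, Fin.val_castSucc, Fin.val_succ, Fin.val_rev, Fin.val_rev]
    omega
  have h1 := hL.perpDim_add_cornerRank hk hm h hR hle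
  have h2 := hL'.perpDim_add_cornerRank hk hm h' hR' hle
  have e1 : m - ((a.rev.castSucc : Fin (m + 1)) : ℕ) = a + 1 := by
    rw [Fin.val_castSucc, Fin.val_rev]
    omega
  have e2 : m - ((b.rev.succ : Fin (m + 1)) : ℕ) = b := by
    rw [Fin.val_succ, Fin.val_rev]
    omega
  rw [e1, e2] at h1 h2
  omega

theorem IsNonoppositeGeodesic.relationOf_subset (hk : k < W.wittIndex) (hm : 1 ≤ m)
    (hL : W.IsNonoppositeGeodesic L) (hL' : W.IsNonoppositeGeodesic L')
    (h : W.Induces M L) (hR : W.SatisfiesR1 M) (h' : W.Induces M' L') (hR' : W.SatisfiesR1 M')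
    (hdim : ∀ i j, W.perpDim (L i) (L j) = W.perpDim (L' i) (L' j)) {a : Fin m}
    (hagree : ∀ i < a, ∀ j, (i, j) ∈ W.relationOf M ↔ (i, j) ∈ W.relationOf M') (b : Fin m)
    (hab : (a, b) ∈ W.relationOf M) : (a, b) ∈ W.relationOf M' := by
  by_contra hab'
  by_cases hρ' : ∀ c, (a, c) ∈ W.relationOf M' → c < b
  · have := hL.perpDim_add_one_eq hk hm hL' h hR h' hR' hagree hab hρ'
    rw [hdim] at this
    omega
  · push Not at hρ'
    obtain ⟨c, hac, hbc⟩ := hρ'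
    have hbc : b < c := lt_of_le_of_ne hbc fun he => hab' (he ▸ hac)
    have := hL'.perpDim_add_one_eq hk hm hL h' hR' h hR (fun i hi j => (hagree i hi j).symm) hac
      fun d hd => hR.right_unique hd hab ▸ hbc
    rw [hdim] at this
    omega

theorem IsNonoppositeGeodesic.forall_perpDim_eq_iff (hk : k < W.wittIndex) (hm : 1 ≤ m)
    (hL : W.IsNonoppositeGeodesic L) (hL' : W.IsNonoppositeGeodesic L')
    (h : W.Induces M L) (hR : W.SatisfiesR1 M) (h' : W.Induces M' L') (hR' : W.SatisfiesR1 M') :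
    (∀ i j, W.perpDim (L i) (L j) = W.perpDim (L' i) (L' j)) ↔
      W.relationOf M = W.relationOf M' := by
  constructor
  · intro hdim
    suffices H : ∀ a b : Fin m, (a, b) ∈ W.relationOf M ↔ (a, b) ∈ W.relationOf M' from
      Set.ext fun ⟨a, b⟩ => H a b
    intro a
    induction a using WellFoundedLT.induction with
    | ind a ih =>
      exact fun b => ⟨hL.relationOf_subset hk hm hL' h hR h' hR' hdim ih b,
        hL'.relationOf_subset hk hm hL h' hR' h hR (fun i j => (hdim i j).symm)
          (fun i hi j => (ih i hi j).symm) b⟩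
  · intro hρ
    have key : ∀ i j : Fin (m + 1), i ≤ j →
        W.perpDim (L i) (L j) = W.perpDim (L' i) (L' j) := fun i j hij => by
      have h1 := hL.perpDim_add_cornerRank hk hm h hR hij
      have h2 := hL'.perpDim_add_cornerRank hk hm h' hR' hij
      rw [hρ] at h1
      omega
    intro i j
    rcases le_total i j with hij | hij
    · exact key i j hij
    · rw [perpDim_comm, key j i hij, perpDim_comm]

end FormedSpace

/-! ### Counting closer neighbours -/

section Transport

variable {K V V' : Type*} [Field K] [AddCommGroup V] [Module K V] [FiniteDimensional K V]
  [AddCommGroup V'] [Module K V'] [FiniteDimensional K V']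

theorem Submodule.exists_linearEquiv_extending (hV : finrank K V = finrank K V')
    {A : Submodule K V} {A' : Submodule K V'} (f : A ≃ₗ[K] A') :
    ∃ g : V ≃ₗ[K] V', ∀ a : A, g a = f a := by
  obtain ⟨C, hC⟩ := A.exists_isCompl
  obtain ⟨C', hC'⟩ := A'.exists_isCompl
  have h1 := Submodule.finrank_add_eq_of_isCompl hC
  have h2 := Submodule.finrank_add_eq_of_isCompl hC'
  have h3 := f.finrank_eq
  let e : C ≃ₗ[K] C' := LinearEquiv.ofFinrankEq C C' (by omega)
  refine ⟨(Submodule.prodEquivOfIsCompl A C hC).symm.trans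
    ((f.prodCongr e).trans (Submodule.prodEquivOfIsCompl A' C' hC')), fun a => ?_⟩
  simp

/-- The general linear group is transitive on pairs `I ≤ X` of subspaces of given dimensions. -/
theorem Submodule.exists_linearEquiv_map_eq {I X I' X' : Submodule K V} (hIX : I ≤ X)
    (hIX' : I' ≤ X') (hI : finrank K I = finrank K I') (hX : finrank K X = finrank K X') :
    ∃ g : V ≃ₗ[K] V, I.map (g : V →ₗ[K] V) = I' ∧ X.map (g : V →ₗ[K] V) = X' := by
  let e : I.submoduleOf X ≃ₗ[K] I'.submoduleOf X' :=
    ((Submodule.submoduleOfEquivOfLe hIX).trans (LinearEquiv.ofFinrankEq I I' hI)).trans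
      (Submodule.submoduleOfEquivOfLe hIX').symm
  obtain ⟨f, hf⟩ := Submodule.exists_linearEquiv_extending hX e
  obtain ⟨g, hg⟩ := Submodule.exists_linearEquiv_extending (V := V) (V' := V) rfl f
  refine ⟨g, ?_, ?_⟩
  · refine Submodule.eq_of_le_of_finrank_eq ?_ (by rw [LinearEquiv.finrank_map_eq, hI])
    rintro _ ⟨v, hv, rfl⟩
    have h1 := hf ⟨⟨v, hIX hv⟩, hv⟩
    have h2 := hg ⟨v, hIX hv⟩
    rw [h1] at h2
    change g v ∈ I'
    rw [h2]
    exact (e ⟨⟨v, hIX hv⟩, hv⟩).2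
  · refine Submodule.eq_of_le_of_finrank_eq ?_ (by rw [LinearEquiv.finrank_map_eq, hX])
    rintro _ ⟨v, hv, rfl⟩
    change g v ∈ X'
    rw [hg ⟨v, hv⟩]
    exact Subtype.prop _

/-- The `r`-dimensional subspaces between `I` and `X`. -/
def Submodule.intervalOfFinrank (I X : Submodule K V) (r : ℕ) : Set (Submodule K V) :=
  {F | I ≤ F ∧ F ≤ X ∧ finrank K F = r}

theorem Submodule.ncard_intervalOfFinrank_eq {I X I' X' : Submodule K V} (hIX : I ≤ X)
    (hIX' : I' ≤ X') (hI : finrank K I = finrank K I') (hX : finrank K X = finrank K X')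
    (r : ℕ) : (I.intervalOfFinrank X r).ncard = (I'.intervalOfFinrank X' r).ncard := by
  obtain ⟨g, rfl, rfl⟩ := Submodule.exists_linearEquiv_map_eq hIX hIX' hI hX
  have hinj : Function.Injective (Submodule.map (g : V →ₗ[K] V)) :=
    Submodule.map_injective_of_injective g.injective
  rw [← Set.ncard_image_of_injective _ hinj]
  congr 1
  ext F
  constructor
  · rintro ⟨F, ⟨h1, h2, h3⟩, rfl⟩
    exact ⟨Submodule.map_mono h1, Submodule.map_mono h2, by rw [LinearEquiv.finrank_map_eq, h3]⟩
  · rintro ⟨h1, h2, h3⟩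
    have hF : (F.comap (g : V →ₗ[K] V)).map (g : V →ₗ[K] V) = F :=
      Submodule.map_comap_eq_of_surjective g.surjective F
    refine ⟨F.comap (g : V →ₗ[K] V), ⟨Submodule.map_le_iff_le_comap.1 h1, ?_, ?_⟩, hF⟩
    · rw [← hF] at h2
      exact (Submodule.map_le_map_iff_of_injective g.injective _ _).1 h2
    · rw [← LinearEquiv.finrank_map_eq g, hF, h3]

theorem Submodule.finite_of_finite_field [Finite K] : Finite (Submodule K V) :=
  have : Finite V := Module.finite_of_finite K
  Finite.of_injective (fun U : Submodule K V => (U : Set V)) SetLike.coe_injective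

theorem Submodule.ncard_intervalOfFinrank_lt [Finite K] {I U I' U' : Submodule K V} (hIU : I ≤ U)
    (hIU' : I' ≤ U') (hI : finrank K I = finrank K I') (hU : finrank K U < finrank K U') :
    (I.intervalOfFinrank U (finrank K I + 1)).ncard <
      (I'.intervalOfFinrank U' (finrank K I' + 1)).ncard := by
  have := Submodule.finite_of_finite_field (K := K) (V := V)
  have hle := Submodule.finrank_mono hIU
  obtain ⟨U₁, h1, h2, h3⟩ := Submodule.exists_between_finrank_eq hIU' (n := finrank K U)
    (by omega) hU.le
  rw [hI, Submodule.ncard_intervalOfFinrank_eq hIU h1 hI h3.symm]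
  refine Set.ncard_lt_ncard ⟨fun F hF => ⟨hF.1, hF.2.1.trans h2, hF.2.2⟩, fun hsub => ?_⟩
    (Set.toFinite _)
  obtain ⟨v, hv, hvU⟩ : ∃ v ∈ U', v ∉ U₁ := by
    by_contra! h
    have := Submodule.finrank_mono (R := K) (show U' ≤ U₁ from h)
    omega
  have hmem : I' ⊔ Submodule.span K {v} ∈ I'.intervalOfFinrank U' (finrank K I' + 1) :=
    ⟨le_sup_left, sup_le hIU' ((Submodule.span_singleton_le_iff_mem _ _).2 hv),
      Submodule.finrank_sup_span_singleton fun h => hvU (h1 h)⟩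
  exact hvU ((hsub hmem).2.1 (Submodule.mem_sup_right (Submodule.mem_span_singleton_self v)))

end Transport

namespace SimpleGraph

variable {α : Type*} {G : SimpleGraph α}

theorem Iso.dist_apply_le (φ : G ≃g G) {u v : α} (h : G.Reachable u v) :
    G.dist (φ u) (φ v) ≤ G.dist u v := by
  obtain ⟨p, hp⟩ := h.exists_walk_length_eq_dist
  rw [← hp, ← SimpleGraph.Walk.length_map φ.toHom p]
  exact SimpleGraph.dist_le (p.map φ.toHom)

theorem Iso.dist_apply (φ : G ≃g G) (u v : α) : G.dist (φ u) (φ v) = G.dist u v := by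
  by_cases h : G.Reachable u v
  · refine le_antisymm (φ.dist_apply_le h) ?_
    have := φ.symm.dist_apply_le (φ.reachable_iff.2 h)
    simpa using this
  · rw [SimpleGraph.dist_eq_zero_of_not_reachable h,
      SimpleGraph.dist_eq_zero_of_not_reachable fun h' => h (φ.reachable_iff.1 h')]

/-- The neighbours of `u` that are closer to `v` than `u` is. -/
def closerNeighbors (G : SimpleGraph α) (u v : α) : Set α :=
  {z | G.Adj u z ∧ G.dist z v + 1 = G.dist u v}

theorem Iso.ncard_closerNeighbors (φ : G ≃g G) (u v : α) :
    (G.closerNeighbors (φ u) (φ v)).ncard = (G.closerNeighbors u v).ncard := by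
  rw [← Set.ncard_image_of_injective (G.closerNeighbors u v) φ.injective]
  congr 1
  ext z
  constructor
  · rintro ⟨h1, h2⟩
    refine ⟨φ.symm z, ⟨?_, ?_⟩, φ.apply_symm_apply z⟩
    · rw [← φ.map_adj_iff, φ.apply_symm_apply]
      exact h1
    · have := φ.dist_apply (φ.symm z) v
      rw [φ.apply_symm_apply] at this
      rw [← this, h2, φ.dist_apply]
  · rintro ⟨z, ⟨h1, h2⟩, rfl⟩
    exact ⟨φ.map_adj_iff.2 h1, by rw [φ.dist_apply, φ.dist_apply, h2]⟩

end SimpleGraph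

namespace FormedSpace

variable {K V : Type*} [Field K] [AddCommGroup V] [Module K V] [FiniteDimensional K V]
  {W : FormedSpace K V} {k d : ℕ}

theorem finrank_inf_perp {X Y : W.SingularSubspace k} :
    finrank K (Y.1 ⊓ W.perp X.1 : Submodule K V) =
      finrank K (X.1 ⊓ Y.1 : Submodule K V) + W.perpDim X Y := by
  have := perpDim_add_finrank_inf Y X
  rw [perpDim_comm, inf_comm Y.1] at this
  omega

/-- A neighbour `Z` of `X` closer to `Y` is determined by `Z ∩ Y` and `Z ∩ X`, and for it these are
an extension of `X ∩ Y` by one dimension inside `Y ∩ X^⊥`, and a hyperplane of `X` through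
`X ∩ Y`. -/
theorem inf_mem_intervalOfFinrank_of_mem_closerNeighbors (hk : k < W.wittIndex)
    {X Y Z : W.SingularSubspace k}
    (hd : finrank K (X.1 ⊓ Y.1 : Submodule K V) + d = k) (hpos : 0 < W.perpDim X Y)
    (hZ : Z ∈ (W.polarGrassmannGraph k).closerNeighbors X Y) :
    Z.1 ⊓ Y.1 ∈ (X.1 ⊓ Y.1).intervalOfFinrank (Y.1 ⊓ W.perp X.1)
        (finrank K (X.1 ⊓ Y.1 : Submodule K V) + 1) ∧
      Z.1 ⊓ X.1 ∈ (X.1 ⊓ Y.1).intervalOfFinrank X.1 (k - 1) ∧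
      Z.1 ⊓ X.1 ⊔ Z.1 ⊓ Y.1 = Z.1 := by
  obtain ⟨hadj, hdist⟩ := hZ
  rw [dist_eq_of_perpDim_pos hk hd hpos] at hdist
  obtain ⟨p, -⟩ := exists_walk_length_eq hk hd hpos
  obtain ⟨q, hq⟩ := (hadj.symm.reachable.trans p.reachable).exists_walk_length_eq_dist
  have h1 := le_length_add_finrank_inf hk q
  have h2 := finrank_inf_add_one_of_adj hk hadj
  rw [inf_comm] at h2
  have h3 := Submodule.finrank_sup_add_finrank_inf_eq (Z.1 ⊓ X.1) (Z.1 ⊓ Y.1)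
  have hle : Z.1 ⊓ X.1 ⊓ (Z.1 ⊓ Y.1) ≤ X.1 ⊓ Y.1 := inf_le_inf inf_le_right inf_le_right
  have h4 := Submodule.finrank_mono hle
  have hsup : Z.1 ⊓ X.1 ⊔ Z.1 ⊓ Y.1 ≤ Z.1 := sup_le inf_le_left inf_le_left
  have h5 := Submodule.finrank_mono hsup
  rw [Z.2.2] at h5
  have hI : X.1 ⊓ Y.1 ≤ Z.1 := by
    rw [← Submodule.eq_of_le_of_finrank_le hle (by omega)]
    exact inf_le_left.trans inf_le_left
  refine ⟨⟨le_inf hI inf_le_right, le_inf inf_le_right fun z hz x hx => ?_, by omega⟩,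
    ⟨le_inf hI inf_le_left, inf_le_right, by omega⟩,
    Submodule.eq_of_le_of_finrank_le hsup (by rw [Z.2.2]; omega)⟩
  exact ((adj_iff hk).1 hadj).1.form_eq_zero (Submodule.mem_sup_left hx)
    (Submodule.mem_sup_right hz.1)

theorem ncard_closerNeighbors_le [Finite K] (hk : k < W.wittIndex) {X Y : W.SingularSubspace k}
    (hd : finrank K (X.1 ⊓ Y.1 : Submodule K V) + d = k) (hpos : 0 < W.perpDim X Y) :
    ((W.polarGrassmannGraph k).closerNeighbors X Y).ncard ≤
      ((X.1 ⊓ Y.1).intervalOfFinrank (Y.1 ⊓ W.perp X.1)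
        (finrank K (X.1 ⊓ Y.1 : Submodule K V) + 1)).ncard *
      ((X.1 ⊓ Y.1).intervalOfFinrank X.1 (k - 1)).ncard := by
  have := Submodule.finite_of_finite_field (K := K) (V := V)
  rw [← Set.ncard_prod]
  refine Set.ncard_le_ncard_of_injOn (fun Z => (Z.1 ⊓ Y.1, Z.1 ⊓ X.1)) (fun Z hZ => ?_)
    (fun Z hZ Z' hZ' he => ?_) (Set.toFinite _)
  · obtain ⟨h1, h2, -⟩ := inf_mem_intervalOfFinrank_of_mem_closerNeighbors hk hd hpos hZ
    exact ⟨h1, h2⟩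
  · have h1 := (inf_mem_intervalOfFinrank_of_mem_closerNeighbors hk hd hpos hZ).2.2
    have h2 := (inf_mem_intervalOfFinrank_of_mem_closerNeighbors hk hd hpos hZ').2.2
    obtain ⟨e1, e2⟩ := Prod.mk.inj he
    refine Subtype.ext ?_
    rw [← h1, ← h2, e1, e2]

theorem le_ncard_closerNeighbors [Finite K] (hk : k < W.wittIndex) {X Y : W.SingularSubspace k}
    (hd : finrank K (X.1 ⊓ Y.1 : Submodule K V) + d = k) (hpos : 2 ≤ W.perpDim X Y) :
    ((X.1 ⊓ Y.1).intervalOfFinrank (Y.1 ⊓ W.perp X.1)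
        (finrank K (X.1 ⊓ Y.1 : Submodule K V) + 1)).ncard *
      ((X.1 ⊓ Y.1).intervalOfFinrank X.1 (k - 1)).ncard ≤
      ((W.polarGrassmannGraph k).closerNeighbors X Y).ncard := by
  have := Submodule.finite_of_finite_field (K := K) (V := V)
  rw [← Set.ncard_prod]
  refine (Set.ncard_le_ncard (t := (fun Z : W.SingularSubspace k => (Z.1 ⊓ Y.1, Z.1 ⊓ X.1)) ''
    (W.polarGrassmannGraph k).closerNeighbors X Y) ?_ (Set.toFinite _)).trans
    (Set.ncard_image_le (Set.toFinite _))
  rintro ⟨G, F⟩ ⟨⟨hG, hGY, hGk⟩, ⟨hF, hFX, hFk⟩⟩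
  dsimp only at hG hGY hGk hF hFX hFk
  have hdle := perpDim_le hd
  obtain ⟨Z, -, hadj, hZX, hZY⟩ := exists_adj_of_hyperplane hk hF hFX (by omega) hG hGY hGk
  refine ⟨Z, ⟨hadj, ?_⟩, Prod.ext hZY hZX⟩
  rw [dist_eq_of_perpDim_pos hk hd (by omega)]
  -- `Z` is not opposite to `Y`: a vector of `X ∩ Y^⊥` survives in the hyperplane `F`
  have hZpos : 0 < W.perpDim Z Y := by
    rw [perpDim_pos_iff]
    intro hle
    have h1 : F ⊓ (X.1 ⊓ W.perp Y.1) ≤ X.1 ⊓ Y.1 := by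
      refine le_inf (inf_le_left.trans hFX) (le_trans ?_ hle)
      rw [← hZX]
      exact le_inf (inf_le_left.trans inf_le_left) (inf_le_right.trans inf_le_right)
    have h2 := Submodule.finrank_mono h1
    have h3 := Submodule.finrank_sup_add_finrank_inf_eq F (X.1 ⊓ W.perp Y.1)
    have h4 := Submodule.finrank_mono (sup_le hFX inf_le_left : F ⊔ X.1 ⊓ W.perp Y.1 ≤ X.1)
    have h5 := perpDim_add_finrank_inf X Y
    rw [X.2.2] at h4
    omega
  rw [dist_eq_of_perpDim_pos hk (d := d - 1) (by rw [hZY, hGk]; omega) hZpos]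
  omega

theorem ncard_closerNeighbors_lt [Finite K] (hk : k < W.wittIndex)
    {X Y X' Y' : W.SingularSubspace k}
    (hd : finrank K (X.1 ⊓ Y.1 : Submodule K V) + d = k)
    (hd' : finrank K (X'.1 ⊓ Y'.1 : Submodule K V) + d = k) (hpos : 0 < W.perpDim X Y)
    (hlt : W.perpDim X Y < W.perpDim X' Y') :
    ((W.polarGrassmannGraph k).closerNeighbors X Y).ncard <
      ((W.polarGrassmannGraph k).closerNeighbors X' Y').ncard := by
  have := Submodule.finite_of_finite_field (K := K) (V := V)
  refine (ncard_closerNeighbors_le hk hd hpos).trans_lt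
    (lt_of_lt_of_le ?_ (le_ncard_closerNeighbors hk hd' (by omega)))
  have hle : ∀ X Y : W.SingularSubspace k, X.1 ⊓ Y.1 ≤ Y.1 ⊓ W.perp X.1 := fun X Y =>
    le_inf inf_le_right (inf_le_left.trans X.2.1.le_perp)
  have hI : finrank K (X.1 ⊓ Y.1 : Submodule K V) = finrank K (X'.1 ⊓ Y'.1 : Submodule K V) := by
    omega
  have h1 := Submodule.ncard_intervalOfFinrank_lt (hle X Y) (hle X' Y') hI
    (by rw [finrank_inf_perp, finrank_inf_perp]; omega)
  have h2 := Submodule.ncard_intervalOfFinrank_eq (inf_le_left : X.1 ⊓ Y.1 ≤ X.1)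
    (inf_le_left : X'.1 ⊓ Y'.1 ≤ X'.1) hI (X.2.2.trans X'.2.2.symm) (k - 1)
  have hdle := perpDim_le hd
  rw [h2]
  refine Nat.mul_lt_mul_of_pos_right h1 ?_
  obtain ⟨F, h3, h4, h5⟩ := Submodule.exists_between_finrank_eq
    (inf_le_left : X'.1 ⊓ Y'.1 ≤ X'.1) (n := k - 1) (by omega) (by rw [X'.2.2]; omega)
  exact (Set.ncard_pos (Set.toFinite _)).2 ⟨F, h3, h4, h5⟩

/-- Automorphisms of the graph preserve the dimensions `dim (X ∩ Y^⊥) / (X ∩ Y)` of non-opposite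
vertices at distance `d`, because the number of neighbours of `X` closer to `Y` grows with it. -/
theorem perpDim_apply_eq [Finite K] (hk : k < W.wittIndex)
    (φ : W.polarGrassmannGraph k ≃g W.polarGrassmannGraph k) {X Y : W.SingularSubspace k}
    (hd : finrank K (X.1 ⊓ Y.1 : Submodule K V) + d = k)
    (hd' : finrank K ((φ X).1 ⊓ (φ Y).1 : Submodule K V) + d = k) (hpos : 0 < W.perpDim X Y)
    (hpos' : 0 < W.perpDim (φ X) (φ Y)) : W.perpDim X Y = W.perpDim (φ X) (φ Y) := by
  have hcard := φ.ncard_closerNeighbors X Y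
  rcases lt_trichotomy (W.perpDim X Y) (W.perpDim (φ X) (φ Y)) with h | h | h
  · have := ncard_closerNeighbors_lt hk hd hd' hpos h
    omega
  · exact h
  · have := ncard_closerNeighbors_lt hk hd' hd hpos' h
    omega

end FormedSpace

/-! ### Action of isometries and automorphisms -/

namespace FormedSpace

variable {K V : Type*} [Field K] [AddCommGroup V] [Module K V] {W : FormedSpace K V} {k m : ℕ}
  {L L' : Fin (m + 1) → W.SingularSubspace k}

section Isometry

/-- An isometry acts on the singular `k`-subspaces. -/
def IsIsometry.mapSingular {g : V ≃ₗ[K] V} (hg : W.IsIsometry g) (U : W.SingularSubspace k) :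
    W.SingularSubspace k :=
  ⟨U.1.map (g : V →ₗ[K] V), hg.isSingular_map U.2.1, by
    rw [LinearEquiv.finrank_map_eq, U.2.2]⟩

theorem IsIsometry.isSingular_map_iff {g : V ≃ₗ[K] V} (hg : W.IsIsometry g)
    {U : Submodule K V} : W.IsSingular (U.map (g : V →ₗ[K] V)) ↔ W.IsSingular U := by
  refine ⟨fun h => ?_, hg.isSingular_map⟩
  have h' := hg.symm.isSingular_map h
  rwa [← Submodule.map_comp, show (g.symm : V →ₗ[K] V) ∘ₗ (g : V →ₗ[K] V) = LinearMap.id from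
    LinearMap.ext fun v => g.symm_apply_apply v, Submodule.map_id] at h'

/-- An isometry induces an automorphism of the polar Grassmann graph. -/
def IsIsometry.graphIso {g : V ≃ₗ[K] V} (hg : W.IsIsometry g) (hk : k < W.wittIndex) :
    W.polarGrassmannGraph k ≃g W.polarGrassmannGraph k where
  toFun := hg.mapSingular
  invFun := hg.symm.mapSingular
  left_inv U := Subtype.ext (by
    change (U.1.map (g : V →ₗ[K] V)).map (g.symm : V →ₗ[K] V) = U.1
    rw [← Submodule.map_comp, show (g.symm : V →ₗ[K] V) ∘ₗ (g : V →ₗ[K] V) = LinearMap.id from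
      LinearMap.ext fun v => g.symm_apply_apply v, Submodule.map_id])
  right_inv U := Subtype.ext (by
    change (U.1.map (g.symm : V →ₗ[K] V)).map (g : V →ₗ[K] V) = U.1
    rw [← Submodule.map_comp, show (g : V →ₗ[K] V) ∘ₗ (g.symm : V →ₗ[K] V) = LinearMap.id from
      LinearMap.ext fun v => g.apply_symm_apply v, Submodule.map_id])
  map_rel_iff' := by
    intro X Y
    rw [adj_iff hk, adj_iff hk]
    change W.IsSingular (X.1.map (g : V →ₗ[K] V) ⊔ Y.1.map (g : V →ₗ[K] V)) ∧
      finrank K (X.1.map (g : V →ₗ[K] V) ⊔ Y.1.map (g : V →ₗ[K] V) : Submodule K V) = k + 1 ↔ _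
    rw [← Submodule.map_sup, hg.isSingular_map_iff, LinearEquiv.finrank_map_eq]

theorem IsIsometry.opposite_of_mapSingular {g : V ≃ₗ[K] V} (hg : W.IsIsometry g)
    {X Y : W.SingularSubspace k} (h : W.Opposite (hg.mapSingular X) (hg.mapSingular Y)) :
    W.Opposite X Y := by
  refine ⟨fun he => h.1 (by rw [he]), fun y hy hyX => ?_⟩
  have hmem : ∀ {U : Submodule K V} {v : V}, g v ∈ U.map (g : V →ₗ[K] V) ↔ v ∈ U := fun {U v} =>
    ⟨fun ⟨u, hu, he⟩ => g.injective he ▸ hu, fun hv => ⟨v, hv, rfl⟩⟩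
  obtain ⟨_, ⟨x, hx, rfl⟩, hxY, hform⟩ := h.2 (g y) (hmem.2 hy) (mt hmem.1 hyX)
  exact ⟨x, hx, fun hxY' => hxY (hmem.2 hxY'), by
    rwa [show (g : V →ₗ[K] V) x = g x from rfl, hg.form_eq] at hform⟩

theorem SameIsometryOrbit.isNonoppositeGeodesic (hk : k < W.wittIndex)
    (h : W.SameIsometryOrbit L L') (hL : W.IsNonoppositeGeodesic L) :
    W.IsNonoppositeGeodesic L' := by
  obtain ⟨g, hg, hgL⟩ := h
  obtain rfl : (fun i => hg.graphIso hk (L i)) = L' := funext fun i => Subtype.ext (hgL i)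
  refine ⟨⟨fun i => (hg.graphIso hk).map_adj_iff.2 (hL.1.1 i), ?_⟩, fun hopp => hL.2 ?_⟩
  · rw [SimpleGraph.Iso.dist_apply, hL.1.2]
  · exact hg.opposite_of_mapSingular hopp

theorem SameIsometryOrbit.hasRelation (h : W.SameIsometryOrbit L L') {ρ : Set (Fin m × Fin m)}
    (hL : W.HasRelation L ρ) : W.HasRelation L' ρ := by
  obtain ⟨g, hg, hgL⟩ := h
  obtain ⟨M, hM, hR, rfl⟩ := hL
  refine ⟨⟨g ∘ M.x, g ∘ M.y, g ∘ M.w⟩, ⟨?_, fun i => ?_⟩, ?_, ?_⟩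
  · have := hM.1.map' (g : V →ₗ[K] V) g.ker
    rwa [LinearEquiv.coe_coe, Sum.comp_elim, Sum.comp_elim] at this
  · rw [← hgL i, hM.2 i, Submodule.map_span, Set.image_union, Set.image_union, Set.image_image,
      Set.image_image, ← Set.range_comp]
    rfl
  · simpa only [SatisfiesR1, Function.comp_apply, hg.form_eq] using hR
  · simp only [relationOf, Function.comp_apply, hg.form_eq]

end Isometry

theorem SameIsometryOrbit.sameAutOrbit (hk : k < W.wittIndex) (h : W.SameIsometryOrbit L L') :
    W.SameAutOrbit L L' := by
  obtain ⟨g, hg, hgL⟩ := h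
  exact ⟨hg.graphIso hk, fun i => Subtype.ext (hgL i)⟩

variable [FiniteDimensional K V]

theorem HasRelation.sameIsometryOrbit {ρ : Set (Fin m × Fin m)} (h : W.HasRelation L ρ)
    (h' : W.HasRelation L' ρ) : W.SameIsometryOrbit L L' := by
  obtain ⟨M, hM, hR, rfl⟩ := h
  obtain ⟨M', hM', hR', hρ⟩ := h'
  obtain ⟨g, hg, hx, hy, hw⟩ := exists_isIsometry_of_relationOf_eq hM hR hM' hR' hρ.symm
  refine ⟨g, hg, fun i => ?_⟩
  have hx' : g ∘ M.x = M'.x := funext hx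
  have hy' : g ∘ M.y = M'.y := funext hy
  have hw' : g ∘ M.w = M'.w := funext hw
  rw [hM.2 i, hM'.2 i, Submodule.map_span, Set.image_union, Set.image_union, ← hx', ← hy', ← hw',
    Set.image_comp, Set.image_comp, Set.range_comp]
  rfl

theorem SameAutOrbit.perpDim_eq [Finite K] (hk : k < W.wittIndex) (hm : 1 ≤ m)
    (hL : W.IsNonoppositeGeodesic L) (hL' : W.IsNonoppositeGeodesic L')
    (h : W.SameAutOrbit L L') (i j : Fin (m + 1)) :
    W.perpDim (L i) (L j) = W.perpDim (L' i) (L' j) := by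
  obtain ⟨φ, hφ⟩ := h
  have key : ∀ i j : Fin (m + 1), i < j →
      W.perpDim (L i) (L j) = W.perpDim (L' i) (L' j) := fun i j hij => by
    have h1 := hL.finrank_inf hk hm (i := i) (j := j) hij.le (by omega)
    have h2 := hL'.finrank_inf hk hm (i := i) (j := j) hij.le (by omega)
    have h3 := hL.perpDim_pos hk hm (i := i) (j := j) hij (by omega)
    have h4 := hL'.perpDim_pos hk hm (i := i) (j := j) hij (by omega)
    rw [vertexSeq_val, vertexSeq_val] at h1 h2 h3 h4
    rw [← hφ, ← hφ] at h2 h4 ⊢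
    exact perpDim_apply_eq hk φ h1 h2 h3 h4
  have self : ∀ X : W.SingularSubspace k, W.perpDim X X = 0 := fun X =>
    Nat.le_zero.1 (perpDim_le (by rw [inf_idem, X.2.2, add_zero]))
  rcases lt_trichotomy i j with hij | rfl | hij
  · exact key i j hij
  · rw [self, self]
  · rw [perpDim_comm, key j i hij, perpDim_comm]

end FormedSpace

/-! ### The classification of geodesics by their relation -/

theorem proposition4p3 {K V : Type*} [Field K] [Finite K] [AddCommGroup V] [Module K V]
    [FiniteDimensional K V] (W : FormedSpace K V) (k : ℕ) (hk : 1 ≤ k) (hkω : k < W.wittIndex)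
    (m : ℕ) (hm : 1 ≤ m) :
    -- each geodesic with non-opposite ends has exactly one relation (R1)
    (∀ L : Fin (m + 1) → W.SingularSubspace k, W.IsNonoppositeGeodesic L →
      ∃! ρ : Set (Fin m × Fin m), W.HasRelation L ρ) ∧
    -- same orbit of the automorphism group of the graph if and only if same relation
    (∀ L L' : Fin (m + 1) → W.SingularSubspace k,
      W.IsNonoppositeGeodesic L → W.IsNonoppositeGeodesic L' →
      ∀ ρ ρ' : Set (Fin m × Fin m), W.HasRelation L ρ → W.HasRelation L' ρ' →
        (W.SameAutOrbit L L' ↔ ρ = ρ')) ∧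
    -- the geodesics with a given relation form one orbit of the isometry group
    (∀ (L : Fin (m + 1) → W.SingularSubspace k) (ρ : Set (Fin m × Fin m)),
      W.IsNonoppositeGeodesic L → W.HasRelation L ρ →
        {L' : Fin (m + 1) → W.SingularSubspace k |
            W.IsNonoppositeGeodesic L' ∧ W.HasRelation L' ρ} =
          {L' : Fin (m + 1) → W.SingularSubspace k | W.SameIsometryOrbit L L'}) ∧
    -- different relations are told apart by the dimensions of `(X_i ∩ X_j^⊥) / (X_i ∩ X_j)`
    (∀ L L' : Fin (m + 1) → W.SingularSubspace k,
      W.IsNonoppositeGeodesic L → W.IsNonoppositeGeodesic L' →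
      ∀ ρ ρ' : Set (Fin m × Fin m), W.HasRelation L ρ → W.HasRelation L' ρ' →
        ((∀ i j, W.perpDim (L i) (L j) = W.perpDim (L' i) (L' j)) ↔ ρ = ρ') ∧
        -- numbered from `1`, the vertices below are `X_{m-a}` and `X_{m-b+1}`
        ∀ a b : Fin m, (∀ i < a, ∀ j, (i, j) ∈ ρ ↔ (i, j) ∈ ρ') → (a, b) ∈ ρ →
          (∀ c, (a, c) ∈ ρ' → c < b) →
            W.perpDim (L a.rev.castSucc) (L b.rev.succ) + 1 =
              W.perpDim (L' a.rev.castSucc) (L' b.rev.succ)) := by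
  refine ⟨fun L hL => ?_, fun L L' hL hL' ρ ρ' hρ hρ' => ?_, fun L ρ hL hρ => ?_,
    fun L L' hL hL' ρ ρ' hρ hρ' => ?_⟩
  · obtain ⟨M, hM, hR⟩ := hL.exists_system hkω hm
    refine ⟨W.relationOf M, ⟨M, hM, hR, rfl⟩, ?_⟩
    rintro _ ⟨M', hM', hR', rfl⟩
    exact (hL.forall_perpDim_eq_iff hkω hm hL hM' hR' hM hR).1 fun _ _ => rfl
  · constructor
    · intro h
      obtain ⟨M, hM, hR, rfl⟩ := hρ
      obtain ⟨M', hM', hR', rfl⟩ := hρ'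
      exact (hL.forall_perpDim_eq_iff hkω hm hL' hM hR hM' hR').1 (h.perpDim_eq hkω hm hL hL')
    · rintro rfl
      exact (hρ.sameIsometryOrbit hρ').sameAutOrbit hkω
  · ext L'
    exact ⟨fun h => hρ.sameIsometryOrbit h.2,
      fun h => ⟨h.isNonoppositeGeodesic hkω hL, h.hasRelation hρ⟩⟩
  · obtain ⟨M, hM, hR, rfl⟩ := hρ
    obtain ⟨M', hM', hR', rfl⟩ := hρ'
    exact ⟨hL.forall_perpDim_eq_iff hkω hm hL' hM hR hM' hR',
      fun a b hagree hab hlt => hL.perpDim_add_one_eq hkω hm hL' hM hR hM' hR' hagree hab hlt⟩
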